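/- For $d\ge 1$ let $\mathbb T^d=\mathbb R^d/2\pi\mathbb Z^d$ and, for $\nu>0$, consider $$\partial_t h=\nabla\cdot\big((|\nabla h|^2-1)\nabla h\big)-\nu\Delta^2h\qquad\text{on }\mathbb T^d. \tag{1}$$ By the solution of (1) with smooth initial value $h_0$ we mean the smooth solution ($h\in C([0,T);C^\infty(\mathbb T^d))$ for some $T>0$, $h(0)=h_0$, and (1) pointwise for $0<t<T$). Put $\|\nabla g\|_\infty=\sup_x|\nabla g(x)|$. **Theorem 1.6.** For every $d\ge1$ there is a constant $C_d>1$ depending only on $d$ (in particular not on $\nu$) such that, for every $\nu>0$: 1. for every $\epsilon>0$ there is $h_0\in C^\infty(\mathbb T^d)$ with $\int_{\mathbb T^d}h_0\,dx=0$ and $\|\nabla h_0\|_\infty<1$, and there is a time $t_0>0$, such that the solution $h$ of (1) with initial value $h_0$ exists beyond the time $t_0$ (that is, on some $[0,T)$ with $T>t_0$), and every such solution satisfies $\|\nabla h(t_0)\|_\infty>C_d-\epsilon$; 2. consequently, if $\alpha\in\mathbb R$ is such that all solutions of (1) with smooth initial values satisfy $\|\nabla h(t)\|_\infty\le\max\{\|\nabla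 h_0\|_\infty,\alpha\}$ at all positive times of their existence, then $\alpha\ge C_d$. In dimension $d=1$ one can take $C_1=\|f\|_{L^1(\mathbb R)}$ with $f(x)=\frac1{2\pi}\int_{\mathbb R}e^{-\xi^4}e^{i\xi x}\,d\xi$. -/

import Mathlib

open scoped ContDiff

noncomputable section

namespace ThinFilm

/-- Functions on the torus `ℝ^d / 2πℤ^d` are the functions on `ℝ^d` that are `2π`-periodic in each
coordinate. -/
def IsPeriodic {d : ℕ} (g : EuclideanSpace ℝ (Fin d) → ℝ) : Prop :=
  ∀ (i : Fin d) (x : EuclideanSpace ℝ (Fin d)),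
    g (x + EuclideanSpace.single i (2 * Real.pi)) = g x

/-- Integral of a periodic function over the torus, computed on the fundamental cell `[0, 2π)^d`. -/
def torusIntegral {d : ℕ} (g : EuclideanSpace ℝ (Fin d) → ℝ) : ℝ :=
  ∫ x in {x : EuclideanSpace ℝ (Fin d) | ∀ i, x i ∈ Set.Ico 0 (2 * Real.pi)}, g x

/-- The norm `‖∇g‖_∞ = sup_x |∇g(x)|`, with the Euclidean length of the gradient. It is used for
smooth periodic functions only, for which the supremum is finite. -/
def gradNorm {d : ℕ} (g : EuclideanSpace ℝ (Fin d) → ℝ) : ℝ :=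
  ⨆ x : EuclideanSpace ℝ (Fin d), ‖gradient g x‖

/-- Divergence `∑ i, ∂_i V_i` of a vector field on `ℝ^d`. -/
def divergence {d : ℕ} (V : EuclideanSpace ℝ (Fin d) → EuclideanSpace ℝ (Fin d))
    (x : EuclideanSpace ℝ (Fin d)) : ℝ :=
  ∑ i : Fin d, fderiv ℝ (fun y => V y i) x (EuclideanSpace.single i 1)

/-- The right-hand side `∇ · ((|∇g|² - 1) ∇g) - ν Δ² g` of the equation. -/
def rhs {d : ℕ} (ν : ℝ) (g : EuclideanSpace ℝ (Fin d) → ℝ) (x : EuclideanSpace ℝ (Fin d)) : ℝ :=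
  divergence (fun y => (‖gradient g y‖ ^ 2 - 1) • gradient g y) x
    - ν * Laplacian.laplacian (Laplacian.laplacian g) x

/-- `h` is a smooth solution on the time interval `[0, T)` with initial value `h₀`: it is of class
`C([0, T); C^∞(𝕋^d))` and `∂_t h = ∇ · ((|∇h|² - 1) ∇h) - ν Δ² h` holds pointwise for `0 < t < T`.
(Values of `h` outside `[0, T)` play no role.) -/
structure IsSolution {d : ℕ} (ν T : ℝ) (h₀ : EuclideanSpace ℝ (Fin d) → ℝ)
    (h : ℝ → EuclideanSpace ℝ (Fin d) → ℝ) : Prop where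
  initial : h 0 = h₀
  periodic : ∀ t ∈ Set.Ico 0 T, IsPeriodic (h t)
  smooth : ∀ t ∈ Set.Ico 0 T, ContDiff ℝ ∞ (h t)
  continuous_derivs : ∀ k : ℕ,
    ContinuousOn (fun p : ℝ × EuclideanSpace ℝ (Fin d) => iteratedFDeriv ℝ k (h p.1) p.2)
      (Set.Ico 0 T ×ˢ Set.univ)
  equation : ∀ t ∈ Set.Ioo 0 T, ∀ x : EuclideanSpace ℝ (Fin d),
    HasDerivAt (fun s => h s x) (rhs ν (h t) x) t

/-- The gradient bound with constant `α`: for all smooth initial data `h₀`, the solution satisfies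
`‖∇h(t)‖_∞ ≤ max (‖∇h₀‖_∞) α` at all positive times of its existence. -/
def GradientBound (d : ℕ) (ν α : ℝ) : Prop :=
  ∀ h₀ : EuclideanSpace ℝ (Fin d) → ℝ, ContDiff ℝ ∞ h₀ → IsPeriodic h₀ →
    ∀ (T : ℝ) (h : ℝ → EuclideanSpace ℝ (Fin d) → ℝ), IsSolution ν T h₀ h →
      ∀ t ∈ Set.Ioo 0 T, gradNorm (h t) ≤ max (gradNorm h₀) α

/-- The kernel `f(x) = (2π)^{-d} ∫ e^{-|ξ|⁴} e^{i ξ·x} dξ`, the inverse Fourier transform of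
`e^{-|ξ|⁴}` on `ℝ^d`. -/
def kernel (d : ℕ) (x : EuclideanSpace ℝ (Fin d)) : ℂ :=
  (1 / (2 * Real.pi) ^ d : ℝ) *
    ∫ ξ : EuclideanSpace ℝ (Fin d),
      (Real.exp (-‖ξ‖ ^ 4) : ℂ) * Complex.exp (Complex.I * (inner ℝ ξ x : ℝ))

/-- The norm `‖f‖_{L¹(ℝ^d)}` of the kernel. -/
def kernelL1 (d : ℕ) : ℝ := ∫ x : EuclideanSpace ℝ (Fin d), ‖kernel d x‖

end ThinFilm

end

noncomputable section

namespace ThinFilm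

open MeasureTheory Filter Topology FourierTransform BoundedContinuousFunction
open scoped ENNReal

/-! ### The one-dimensional kernel -/

/-! The one-dimensional constant works in every dimension, because data depending on a single
coordinate stay so. For such data the slope `u` solves `u_t = ∂²(u³ - u) - ν ∂⁴u`. If `u` starts as
a cosine polynomial in `N x`, the mode of frequency `k N` is damped at rate `ν (k N)⁴` while the
cubic term enters only with the factor `(k N)²`. The ratio is at most `1 / (ν N²)`, so for large `N`
the slope is uniformly close, for all times, to its biharmonic heat evolution. A contraction
argument in a weighted Wiener algebra makes this precise (`exists_isMildSolution`), and the
exponential weight makes the mild solution smooth in space.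

The biharmonic heat flow is convolution with a rescaled kernel `K`. At time `l⁴ / (ν N⁴)` its value
at the origin is `∫ K(y) p(l y) dy`, where `p` is the initial profile. Choosing `p` of modulus less
than one with `p(l y)` close to the sign of `K(y)` gives nearly `‖K‖₁` (`exists_amplified_cosPoly`).

The norm exceeds one because `K` has integral one and cannot be nonnegative: its Fourier transform
`exp (-k⁴)` is too flat at the origin for a positive measure (`one_lt_integral_abs_lineKernel`).

Finally, an `L²` energy estimate gives uniqueness (`IsSolution.torusIntegral_sub_sq_eq_zero`), so
every smooth solution with the constructed initial value, not only the constructed one, has the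
large slope at the origin. -/

theorem integral_exp_mul_even {u : ℝ → ℝ} (hu : Integrable u) (he : ∀ x, u (-x) = u x) (c : ℝ) :
    ∫ v : ℝ, Complex.exp (↑(c * v) * Complex.I) * (u v : ℂ) =
      ((∫ v, u v * Real.cos (c * v) : ℝ) : ℂ) := by
  have hc : Integrable fun v => u v * Real.cos (c * v) :=
    hu.mul_bdd (c := 1) (by fun_prop) (ae_of_all _ fun v => by simpa using Real.abs_cos_le_one _)
  have hs : Integrable fun v => u v * Real.sin (c * v) :=
    hu.mul_bdd (c := 1) (by fun_prop) (ae_of_all _ fun v => by simpa using Real.abs_sin_le_one _)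
  have h0 : ∫ v, u v * Real.sin (c * v) = 0 := by
    have := integral_neg_eq_self (fun v => u v * Real.sin (c * v)) volume
    simp only [he, mul_neg, Real.sin_neg, integral_neg] at this
    linarith
  have : ∀ v : ℝ, Complex.exp (↑(c * v) * Complex.I) * (u v : ℂ) =
      ((u v * Real.cos (c * v) : ℝ) : ℂ) + ((u v * Real.sin (c * v) : ℝ) : ℂ) * Complex.I := by
    intro v
    rw [Complex.exp_mul_I, ← Complex.ofReal_cos, ← Complex.ofReal_sin]
    push_cast
    ring
  simp_rw [this]
  rw [integral_add hc.ofReal (hs.ofReal.mul_const _), integral_mul_const, integral_complex_ofReal,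
    integral_complex_ofReal, h0]
  simp

theorem integrable_pow_mul_exp_neg_pow_four (m : ℕ) :
    Integrable fun x : ℝ => x ^ m * Real.exp (-x ^ 4) := by
  -- Comparison with a Gaussian: `-x⁴ ≤ 1 - x²`, which accounts for the factor `exp 1`.
  have h := (integrable_rpow_mul_exp_neg_mul_sq (b := 1) one_pos (s := m)
    (by have : (0 : ℝ) ≤ m := m.cast_nonneg
        linarith)).const_mul (Real.exp 1)
  refine h.mono (by fun_prop) (ae_of_all _ fun x => ?_)
  simp only [norm_mul, Real.norm_eq_abs, Real.abs_exp, Real.rpow_natCast]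
  rw [← mul_assoc, mul_comm (Real.exp 1), mul_assoc, ← Real.exp_add]
  gcongr
  nlinarith [sq_nonneg (x ^ 2 - 1)]

theorem integrable_exp_neg_pow_four : Integrable fun x : ℝ => Real.exp (-x ^ 4) := by
  simpa using integrable_pow_mul_exp_neg_pow_four 0

/-- The inverse Fourier transform of `exp (-ξ ^ 4)` on the line. -/
def lineKernel (x : ℝ) : ℝ :=
  1 / (2 * Real.pi) * ∫ ξ : ℝ, Real.exp (-ξ ^ 4) * Real.cos (x * ξ)

theorem lineKernel_neg (x : ℝ) : lineKernel (-x) = lineKernel x := by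
  simp [lineKernel]

theorem lineKernel_abs (x : ℝ) : lineKernel |x| = lineKernel x := by
  rcases abs_choice x with h | h <;> simp [h, lineKernel_neg]

theorem continuous_lineKernel : Continuous lineKernel := by
  refine continuous_const.mul (continuous_of_dominated (bound := fun ξ => Real.exp (-ξ ^ 4))
    (fun x => by fun_prop) (fun x => ae_of_all _ fun ξ => ?_) integrable_exp_neg_pow_four
    (ae_of_all _ fun ξ => by fun_prop))
  rw [norm_mul, Real.norm_eq_abs, Real.abs_exp]
  exact mul_le_of_le_one_right (Real.exp_pos _).le (by simpa using Real.abs_cos_le_one _)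

theorem fourier_exp_neg_pow_four (w : ℝ) :
    𝓕 (fun x : ℝ => (Real.exp (-x ^ 4) : ℂ)) w =
      ((2 * Real.pi * lineKernel (2 * Real.pi * w) : ℝ) : ℂ) := by
  have h := integral_exp_mul_even integrable_exp_neg_pow_four
    (fun x => by simp [Even.neg_pow (by decide : Even 4)]) (-2 * Real.pi * w)
  rw [Real.fourier_real_eq_integral_exp_smul]
  have e : ∀ v : ℝ, -2 * Real.pi * v * w = -2 * Real.pi * w * v := fun v => by ring
  simp_rw [smul_eq_mul, e, h, ← lineKernel_neg (2 * Real.pi * w), lineKernel]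
  rw [← mul_assoc, mul_one_div_cancel (by positivity), one_mul]
  congr 4
  funext v
  ring_nf

/-- Two integrable derivatives on one side give decay like `1 / (1 + w²)` on the other. -/
theorem integrable_fourier_exp_neg_pow_four :
    Integrable (𝓕 (fun x : ℝ => (Real.exp (-x ^ 4) : ℂ))) := by
  set g : ℝ → ℂ := fun x => (Real.exp (-x ^ 4) : ℂ) with hg
  have hd : ∀ x : ℝ, HasDerivAt g ((-4 * (x ^ 3 * Real.exp (-x ^ 4)) : ℝ) : ℂ) x := by
    intro x
    have := ((hasDerivAt_pow 4 x).neg.exp).ofReal_comp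
    convert! this using 1
    simp only [Pi.neg_apply]
    push_cast
    ring
  have hd2 : ∀ x : ℝ, HasDerivAt (fun x : ℝ => ((-4 * (x ^ 3 * Real.exp (-x ^ 4)) : ℝ) : ℂ))
      ((16 * (x ^ 6 * Real.exp (-x ^ 4)) - 12 * (x ^ 2 * Real.exp (-x ^ 4)) : ℝ) : ℂ) x := by
    intro x
    have := (((hasDerivAt_pow 3 x).mul (hasDerivAt_pow 4 x).neg.exp).const_mul (-4)).ofReal_comp
    convert! this using 1
    simp only [Pi.neg_apply]
    push_cast
    ring
  have e1 : deriv g = fun x : ℝ => ((-4 * (x ^ 3 * Real.exp (-x ^ 4)) : ℝ) : ℂ) :=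
    funext fun x => (hd x).deriv
  have e2 : deriv (deriv g) = fun x : ℝ =>
      ((16 * (x ^ 6 * Real.exp (-x ^ 4)) - 12 * (x ^ 2 * Real.exp (-x ^ 4)) : ℝ) : ℂ) := by
    rw [e1]
    exact funext fun x => (hd2 x).deriv
  have i0 : Integrable g := integrable_exp_neg_pow_four.ofReal
  have i1 : Integrable (deriv g) := by
    rw [e1]
    exact ((integrable_pow_mul_exp_neg_pow_four 3).const_mul _).ofReal
  have i2 : Integrable (deriv (deriv g)) := by
    rw [e2]
    exact (((integrable_pow_mul_exp_neg_pow_four 6).const_mul _).sub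
      ((integrable_pow_mul_exp_neg_pow_four 2).const_mul _)).ofReal
  have f1 := Real.fourier_deriv i0 (fun x => (hd x).differentiableAt) i1
  have f2 := Real.fourier_deriv i1 (by rw [e1]; exact fun x => (hd2 x).differentiableAt) i2
  have b0 : ∀ w, ‖𝓕 g w‖ ≤ ∫ v, ‖g v‖ := fun w =>
    VectorFourier.norm_fourierIntegral_le_integral_norm _ _ _ _ _
  have b2 : ∀ w, ‖𝓕 (deriv (deriv g)) w‖ ≤ ∫ v, ‖deriv (deriv g) v‖ := fun w =>
    VectorFourier.norm_fourierIntegral_le_integral_norm _ _ _ _ _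
  have hc : Continuous (𝓕 g) :=
    VectorFourier.fourierIntegral_continuous Real.continuous_fourierChar continuous_inner i0
  refine ((integrable_inv_one_add_sq).const_mul
    ((∫ v, ‖g v‖) + ∫ v, ‖deriv (deriv g) v‖)).mono' hc.aestronglyMeasurable
    (ae_of_all _ fun w => ?_)
  rw [← div_eq_mul_inv, le_div_iff₀ (by positivity), mul_add, mul_one]
  refine add_le_add (b0 w) (le_trans ?_ (b2 w))
  rw [f2, f1]
  simp only [smul_eq_mul, norm_mul, Complex.norm_real, Complex.norm_I, Complex.norm_ofNat,
    Real.norm_eq_abs, abs_of_pos Real.pi_pos]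
  rw [← sq_abs w]
  have : 1 ≤ 2 * Real.pi := by linarith [Real.pi_gt_three]
  have h1 : 1 ≤ (2 * Real.pi) * (2 * Real.pi) := by nlinarith
  have : 0 ≤ ‖𝓕 g w‖ * |w| ^ 2 := by positivity
  nlinarith

theorem integrable_lineKernel : Integrable lineKernel := by
  have h := integrable_fourier_exp_neg_pow_four.re.const_mul (1 / (2 * Real.pi))
  have e : (fun w : ℝ => 1 / (2 * Real.pi) *
      RCLike.re (𝓕 (fun x : ℝ => (Real.exp (-x ^ 4) : ℂ)) w)) =
      fun w => lineKernel (w * (2 * Real.pi)) := by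
    funext w
    rw [fourier_exp_neg_pow_four, mul_comm w]
    have := Real.pi_ne_zero
    simp only [RCLike.re_to_complex, Complex.ofReal_re]
    field_simp
  rw [e] at h
  exact (integrable_comp_mul_right_iff _ (by positivity)).1 h

/-- Fourier inversion; the substitution by `2 * π` converts Mathlib's normalization of the
transform, and evenness of the kernel leaves only the cosine. -/
theorem integral_lineKernel_mul_cos (k : ℝ) :
    ∫ y, lineKernel y * Real.cos (k * y) = Real.exp (-k ^ 4) := by
  have h := congrFun (Continuous.fourierInv_fourier_eq (f := fun x : ℝ => (Real.exp (-x ^ 4) : ℂ))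
    (by fun_prop) integrable_exp_neg_pow_four.ofReal integrable_fourier_exp_neg_pow_four) k
  rw [Real.fourierInv_eq'] at h
  simp_rw [fourier_exp_neg_pow_four, smul_eq_mul] at h
  have e := integral_exp_mul_even integrable_lineKernel lineKernel_neg k
  have c := Measure.integral_comp_mul_left
    (fun y : ℝ => Complex.exp (↑(k * y) * Complex.I) * (lineKernel y : ℂ)) (2 * Real.pi)
  rw [e, abs_of_pos (by positivity)] at c
  have h2 : (∫ v : ℝ, Complex.exp (↑(2 * Real.pi * inner ℝ v k) * Complex.I) *
      ((2 * Real.pi * lineKernel (2 * Real.pi * v) : ℝ) : ℂ)) = (2 * Real.pi : ℝ) *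
      ∫ v : ℝ, Complex.exp (↑(k * (2 * Real.pi * v)) * Complex.I) *
        (lineKernel (2 * Real.pi * v) : ℂ) := by
    rw [← integral_const_mul]
    congr 1
    funext v
    have : 2 * Real.pi * inner ℝ v k = k * (2 * Real.pi * v) := by
      simp [inner]
      ring
    rw [this]
    push_cast
    ring
  rw [h2, c] at h
  have hp : (Real.pi : ℂ) ≠ 0 := by exact_mod_cast Real.pi_ne_zero
  rw [Complex.real_smul, ← mul_assoc, ← Complex.ofReal_mul,
    mul_inv_cancel₀ (by positivity), Complex.ofReal_one, one_mul] at h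
  exact_mod_cast h

/-- Since the kernel has integral one, an `L¹` norm of at most one would make it nonnegative almost
everywhere. Then `φ(k) = ∫ K (1 - cos (k y))` could shrink at most by a factor 4 when `k` is halved,
whereas `1 - exp (-k⁴)` shrinks asymptotically by 16. -/
theorem one_lt_integral_abs_lineKernel : 1 < ∫ y, |lineKernel y| := by
  have h1 : ∫ y, lineKernel y = 1 := by simpa using integral_lineKernel_mul_cos 0
  by_contra! hle
  have hnn : 0 ≤ᵐ[volume] lineKernel := by
    have h0 : ∫ y, (|lineKernel y| - lineKernel y) = 0 := by
      refine le_antisymm ?_ (integral_nonneg fun y => sub_nonneg.2 (le_abs_self _))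
      rw [integral_sub integrable_lineKernel.abs integrable_lineKernel, h1]
      linarith
    rw [integral_eq_zero_iff_of_nonneg (fun y => sub_nonneg.2 (le_abs_self _))
      (integrable_lineKernel.abs.sub integrable_lineKernel)] at h0
    filter_upwards [h0] with y hy
    have : |lineKernel y| = lineKernel y := by simpa [sub_eq_zero] using hy
    exact this ▸ abs_nonneg _
  have hi : ∀ k : ℝ, Integrable fun y => lineKernel y * Real.cos (k * y) := fun k =>
    integrable_lineKernel.mul_bdd (c := 1) (by fun_prop)
      (ae_of_all _ fun v => by simpa using Real.abs_cos_le_one _)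
  have hI : ∀ k : ℝ, ∫ y, lineKernel y * (1 - Real.cos (k * y)) = 1 - Real.exp (-k ^ 4) := by
    intro k
    simp_rw [mul_sub, mul_one]
    rw [integral_sub integrable_lineKernel (hi k), h1, integral_lineKernel_mul_cos]
  have hint : ∀ k : ℝ, Integrable fun y => lineKernel y * (1 - Real.cos (k * y)) := by
    intro k
    simp_rw [mul_sub, mul_one]
    exact integrable_lineKernel.sub (hi k)
  have hdouble : ∀ k : ℝ, 1 - Real.exp (-(2 * k) ^ 4) ≤ 4 * (1 - Real.exp (-k ^ 4)) := by
    intro k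
    rw [← hI, ← hI, ← integral_const_mul]
    refine integral_mono_ae (hint _) ((hint _).const_mul _) ?_
    filter_upwards [hnn] with y hy
    have hy' : 0 ≤ lineKernel y := hy
    -- With `θ = k y`: `1 - cos 2θ = 2 (1 - cos θ) (1 + cos θ)`. Integration against the kernel is
    -- where its sign is used.
    have : 1 - Real.cos (2 * k * y) ≤ 4 * (1 - Real.cos (k * y)) := by
      rw [mul_assoc, Real.cos_two_mul]
      nlinarith [sq_nonneg (1 - Real.cos (k * y)), Real.cos_le_one (k * y)]
    calc _ ≤ lineKernel y * (4 * (1 - Real.cos (k * y))) := by gcongr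
      _ = _ := by ring
  have hpow : ∀ n : ℕ, 1 - Real.exp (-1) ≤ 4 ^ n * (1 - Real.exp (-((1 / 2) ^ n) ^ 4)) := by
    intro n
    induction n with
    | zero => simp
    | succ n ih =>
      have := hdouble ((1 / 2) ^ (n + 1))
      rw [show (2 : ℝ) * (1 / 2) ^ (n + 1) = (1 / 2) ^ n by rw [pow_succ]; ring] at this
      rw [pow_succ (4 : ℝ)]
      have h4 : (0 : ℝ) < 4 ^ n := by positivity
      nlinarith
  have hbound : ∀ n : ℕ, 1 - Real.exp (-1) ≤ (1 / 4) ^ n := by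
    intro n
    refine (hpow n).trans ?_
    have := Real.add_one_le_exp (-((1 / 2 : ℝ) ^ n) ^ 4)
    have e : (4 : ℝ) ^ n * ((1 / 2) ^ n) ^ 4 = (1 / 4) ^ n := by
      rw [← pow_mul, mul_comm n 4, pow_mul, ← mul_pow]
      norm_num
    rw [← e]
    gcongr
    linarith
  have hlim := ge_of_tendsto' (tendsto_pow_atTop_nhds_zero_of_lt_one (r := (1 / 4 : ℝ))
    (by norm_num) (by norm_num)) hbound
  have : Real.exp (-1) < 1 := by rw [Real.exp_lt_one_iff]; norm_num
  linarith

theorem kernel_one (x : EuclideanSpace ℝ (Fin 1)) : kernel 1 x = (lineKernel (x 0) : ℂ) := by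
  have h := integral_exp_mul_even integrable_exp_neg_pow_four
    (fun x => by simp [Even.neg_pow (by decide : Even 4)]) (x 0)
  have e := ((PiLp.volume_preserving_toLp (Fin 1)).comp
    ((volume_preserving_funUnique (Fin 1) ℝ).symm _)).integral_comp
      ((MeasurableEquiv.funUnique (Fin 1) ℝ).symm.trans
        (MeasurableEquiv.toLp 2 (Fin 1 → ℝ))).measurableEmbedding
      (fun ξ : EuclideanSpace ℝ (Fin 1) =>
        (Real.exp (-‖ξ‖ ^ 4) : ℂ) * Complex.exp (Complex.I * (inner ℝ ξ x : ℝ)))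
  rw [kernel, ← e, lineKernel]
  push_cast
  rw [pow_one, ← h]
  congr 2
  funext v
  have hn : ‖WithLp.toLp 2 (fun _ : Fin 1 => v)‖ ^ 4 = v ^ 4 := by
    rw [show 4 = 2 * 2 from rfl, pow_mul, EuclideanSpace.norm_sq_eq, pow_mul]
    simp
  have hi : inner ℝ (WithLp.toLp 2 (fun _ : Fin 1 => v)) x = x 0 * v := by
    simp [PiLp.inner_apply]
  have hf : (WithLp.toLp 2 ∘ (MeasurableEquiv.funUnique (Fin 1) ℝ).symm) v =
      WithLp.toLp 2 (fun _ : Fin 1 => v) := by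
    rfl
  rw [hf]
  simp only [← Complex.ofReal_exp, ← Complex.ofReal_pow, ← Complex.ofReal_neg, hn, hi]
  rw [mul_comm, mul_comm Complex.I]

theorem kernelL1_one : kernelL1 1 = ∫ y, |lineKernel y| := by
  have e := ((PiLp.volume_preserving_toLp (Fin 1)).comp
    ((volume_preserving_funUnique (Fin 1) ℝ).symm _)).integral_comp
      ((MeasurableEquiv.funUnique (Fin 1) ℝ).symm.trans
        (MeasurableEquiv.toLp 2 (Fin 1 → ℝ))).measurableEmbedding
      (fun ξ : EuclideanSpace ℝ (Fin 1) => ‖kernel 1 ξ‖)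
  rw [kernelL1, ← e]
  congr 1
  funext v
  rw [kernel_one, Complex.norm_real, Real.norm_eq_abs]
  rfl

/-! ### Cosine polynomials -/

/-- The cosine polynomial `∑ k, c k * cos (k * x)`. -/
def cosPoly (c : ℤ →₀ ℝ) (x : ℝ) : ℝ :=
  Finsupp.linearCombination ℝ (fun k : ℤ => Real.cos (k * x)) c

theorem cosPoly_eq_sum (c : ℤ →₀ ℝ) (x : ℝ) :
    cosPoly c x = ∑ k ∈ c.support, c k * Real.cos (k * x) := by
  simp [cosPoly, Finsupp.linearCombination_apply, Finsupp.sum]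

@[simp] theorem cosPoly_zero (x : ℝ) : cosPoly 0 x = 0 := by simp [cosPoly]

theorem cosPoly_add (c d : ℤ →₀ ℝ) (x : ℝ) : cosPoly (c + d) x = cosPoly c x + cosPoly d x := by
  simp [cosPoly]

theorem cosPoly_single (k : ℤ) (a x : ℝ) :
    cosPoly (Finsupp.single k a) x = a * Real.cos (k * x) := by simp [cosPoly]

theorem exists_cosPoly_cos_mul (c : ℤ →₀ ℝ) :
    ∃ c' : ℤ →₀ ℝ, ∀ x, cosPoly c' x = Real.cos x * cosPoly c x := by
  induction c using Finsupp.induction_linear with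
  | zero => exact ⟨0, by simp⟩
  | add c d hc hd =>
    obtain ⟨c', hc⟩ := hc
    obtain ⟨d', hd⟩ := hd
    exact ⟨c' + d', fun x => by rw [cosPoly_add, cosPoly_add, hc, hd, mul_add]⟩
  | single k a =>
    refine ⟨Finsupp.single (k + 1) (a / 2) + Finsupp.single (k - 1) (a / 2), fun x => ?_⟩
    simp only [cosPoly_add, cosPoly_single]
    push_cast
    rw [add_mul, sub_mul, one_mul, Real.cos_add, Real.cos_sub]
    ring

theorem exists_cosPoly_eq_eval_cos (P : Polynomial ℝ) :
    ∃ c : ℤ →₀ ℝ, ∀ x, cosPoly c x = P.eval (Real.cos x) := by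
  induction P using Polynomial.induction_on' with
  | add p q hp hq =>
    obtain ⟨c, hc⟩ := hp
    obtain ⟨d, hd⟩ := hq
    exact ⟨c + d, fun x => by rw [cosPoly_add, hc, hd, Polynomial.eval_add]⟩
  | monomial n a =>
    induction n with
    | zero => exact ⟨Finsupp.single 0 a, fun x => by simp [cosPoly_single]⟩
    | succ n ih =>
      obtain ⟨c, hc⟩ := ih
      obtain ⟨c', hc'⟩ := exists_cosPoly_cos_mul c
      refine ⟨c', fun x => ?_⟩
      rw [hc', hc, Polynomial.eval_monomial, Polynomial.eval_monomial]
      ring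

/-- Antisymmetrizing under the half-period shift keeps only odd frequencies, so the mean disappears,
as it must for the slope of a periodic function. -/
theorem exists_cosPoly_odd_part (c : ℤ →₀ ℝ) :
    ∃ c' : ℤ →₀ ℝ, c' 0 = 0 ∧
      ∀ x, cosPoly c' x = (cosPoly c x - cosPoly c (x + Real.pi)) / 2 := by
  induction c using Finsupp.induction_linear with
  | zero => exact ⟨0, by simp⟩
  | add c d hc hd =>
    obtain ⟨c', hc0, hc⟩ := hc
    obtain ⟨d', hd0, hd⟩ := hd
    refine ⟨c' + d', by simp [hc0, hd0], fun x => ?_⟩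
    simp only [cosPoly_add, hc, hd]
    ring
  | single k a =>
    refine ⟨Finsupp.single k (a * (1 - (-1) ^ k) / 2), ?_, fun x => ?_⟩
    · rw [Finsupp.single_apply]
      split_ifs with h <;> simp [h]
    · simp only [cosPoly_single]
      rw [mul_add, Real.cos_add_int_mul_pi]
      ring

theorem integral_lineKernel_mul_cosPoly (c : ℤ →₀ ℝ) (l : ℝ) :
    ∫ y, lineKernel y * cosPoly c (l * y) =
      ∑ k ∈ c.support, c k * Real.exp (-(l * k) ^ 4) := by
  have hi : ∀ k : ℤ, Integrable fun y => lineKernel y * (c k * Real.cos (k * (l * y))) := by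
    intro k
    refine integrable_lineKernel.mul_bdd (c := |c k|) (by fun_prop) (ae_of_all _ fun v => ?_)
    rw [norm_mul, Real.norm_eq_abs]
    exact mul_le_of_le_one_right (abs_nonneg _) (by simpa using Real.abs_cos_le_one _)
  simp_rw [cosPoly_eq_sum, Finset.mul_sum]
  rw [integral_finsetSum _ fun k _ => hi k]
  refine Finset.sum_congr rfl fun k _ => ?_
  rw [← integral_lineKernel_mul_cos, ← integral_const_mul]
  congr 1
  funext y
  ring_nf

/-! ### Initial slopes that are amplified by almost `‖f‖_{L¹}` -/

/-- A continuous odd function on `[-1, 1]` whose composition with `y ↦ cos (y / m)` approximates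
the sign of the kernel. -/
def signProfile (m s : ℝ) : ℝ :=
  (1 - 1 / m) * (s * (m * lineKernel (m * Real.arccos |s|) /
    (1 + m * |lineKernel (m * Real.arccos |s|)|)))

theorem continuous_signProfile {m : ℝ} (hm : 1 ≤ m) : Continuous (signProfile m) := by
  have h : Continuous fun s : ℝ => lineKernel (m * Real.arccos |s|) :=
    continuous_lineKernel.comp (continuous_const.mul (Real.continuous_arccos.comp continuous_abs))
  unfold signProfile
  refine continuous_const.mul (continuous_id.mul ((continuous_const.mul h).div
    (continuous_const.add (continuous_const.mul h.abs)) fun s => ?_))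
  have : 0 ≤ m * |lineKernel (m * Real.arccos |s|)| := by positivity
  linarith

theorem signProfile_neg (m s : ℝ) : signProfile m (-s) = -signProfile m s := by
  simp only [signProfile, abs_neg]
  ring

theorem abs_signProfile_le {m s : ℝ} (hm : 1 ≤ m) (hs : |s| ≤ 1) :
    |signProfile m s| ≤ 1 - 1 / m := by
  have h0 : 0 ≤ 1 - 1 / m := sub_nonneg.2 ((div_le_one (by linarith)).2 hm)
  have h1 : 0 ≤ m * |lineKernel (m * Real.arccos |s|)| := by positivity
  rw [signProfile, abs_mul, abs_of_nonneg h0, abs_mul, abs_div, abs_mul,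
    abs_of_pos (by linarith : 0 < m),
    abs_of_pos (by linarith : 0 < 1 + m * |lineKernel (m * Real.arccos |s|)|)]
  refine mul_le_of_le_one_right h0 (mul_le_one₀ hs (by positivity) ?_)
  rw [div_le_one (by linarith)]
  linarith

/-- For fixed `y` and large `m` the angle `y / m` lies within `π / 2` of zero, so `m * arccos |cos
(y / m)| = |y|` and evenness of the kernel recovers `K(y)`. The quotient `m K / (1 + m |K|)` then
tends to the sign of `K` wherever `K(y) ≠ 0`; zeros do no harm because of the prefactor. -/
theorem tendsto_lineKernel_mul_signProfile (y : ℝ) :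
    Tendsto (fun n : ℕ => lineKernel y * signProfile (n + 1) (Real.cos (1 / ((n : ℝ) + 1) * y)))
      atTop (𝓝 |lineKernel y|) := by
  have hz : Tendsto (fun n : ℕ => 1 / ((n : ℝ) + 1)) atTop (𝓝 0) :=
    tendsto_one_div_add_atTop_nhds_zero_nat
  have hy : Tendsto (fun n : ℕ => 1 / ((n : ℝ) + 1) * y) atTop (𝓝 0) := by
    simpa using hz.mul_const y
  have hcos : Tendsto (fun n : ℕ => Real.cos (1 / ((n : ℝ) + 1) * y)) atTop (𝓝 1) := by
    simpa [Function.comp_def] using (Real.continuous_cos.tendsto 0).comp hy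
  have hfrac : Tendsto (fun n : ℕ => |lineKernel y| -
      |lineKernel y| / (1 + ((n : ℝ) + 1) * |lineKernel y|)) atTop (𝓝 |lineKernel y|) := by
    have : Tendsto (fun n : ℕ => |lineKernel y| / (1 + ((n : ℝ) + 1) * |lineKernel y|))
        atTop (𝓝 0) := by
      refine squeeze_zero (fun n => by positivity) (fun n => ?_) hz
      rw [div_le_div_iff₀ (by positivity) (by positivity)]
      nlinarith
    simpa using this.const_sub |lineKernel y|
  have hlim : Tendsto (fun n : ℕ => (1 - 1 / ((n : ℝ) + 1)) *
      (Real.cos (1 / ((n : ℝ) + 1) * y) * (|lineKernel y| -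
      |lineKernel y| / (1 + ((n : ℝ) + 1) * |lineKernel y|)))) atTop (𝓝 |lineKernel y|) := by
    simpa using (hz.const_sub 1).mul (hcos.mul hfrac)
  refine hlim.congr' ?_
  have hev : ∀ᶠ n : ℕ in atTop, |1 / ((n : ℝ) + 1) * y| < Real.pi / 2 := by
    have := hy.abs
    rw [abs_zero] at this
    exact this.eventually_lt_const (by positivity)
  filter_upwards [hev] with n hn
  have hm : (0 : ℝ) < n + 1 := by positivity
  have harg : lineKernel (((n : ℝ) + 1) * Real.arccos |Real.cos (1 / ((n : ℝ) + 1) * y)|) =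
      lineKernel y := by
    have hpos : 0 ≤ Real.cos (1 / ((n : ℝ) + 1) * y) :=
      Real.cos_nonneg_of_mem_Icc ⟨(abs_lt.1 hn).1.le, (abs_lt.1 hn).2.le⟩
    rw [abs_of_nonneg hpos, ← Real.cos_abs, Real.arccos_cos (abs_nonneg _)
      (by linarith [Real.pi_pos]), abs_mul, abs_of_pos (by positivity), ← lineKernel_abs y]
    congr 1
    field_simp
  rw [signProfile, harg]
  have hden : 0 < 1 + ((n : ℝ) + 1) * |lineKernel y| := by positivity
  have : |lineKernel y| - |lineKernel y| / (1 + ((n : ℝ) + 1) * |lineKernel y|) =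
      lineKernel y * (((n : ℝ) + 1) * lineKernel y / (1 + ((n : ℝ) + 1) * |lineKernel y|)) := by
    rw [eq_comm, ← mul_div_assoc, div_eq_iff hden.ne', sub_mul, div_mul_cancel₀ _ hden.ne']
    have := abs_mul_abs_self (lineKernel y)
    linear_combination (-((n : ℝ) + 1)) * this
  rw [this]
  ring

/-- Weierstrass approximation of the sign profile by a polynomial in `cos x`, followed by dominated
convergence. The profile is odd in `cos x`, so passing to the odd part costs no accuracy. -/
theorem exists_amplified_cosPoly {ε : ℝ} (hε : 0 < ε) :
    ∃ (l : ℝ) (c : ℤ →₀ ℝ) (η : ℝ), 0 < l ∧ c 0 = 0 ∧ η < 1 ∧ (∀ x, |cosPoly c x| ≤ η) ∧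
      (∫ y, |lineKernel y|) - ε < ∑ k ∈ c.support, c k * Real.exp (-(l * k) ^ 4) := by
  have key : ∀ n : ℕ, ∃ c : ℤ →₀ ℝ, c 0 = 0 ∧
      ∀ x, |cosPoly c x - signProfile (n + 1) (Real.cos x)| ≤ 1 / (2 * ((n : ℝ) + 1)) := by
    intro n
    have hm : (1 : ℝ) ≤ n + 1 := by simp
    obtain ⟨P, hP⟩ := exists_polynomial_near_of_continuousOn (-1) 1 _
      (continuous_signProfile hm).continuousOn (1 / (2 * ((n : ℝ) + 1))) (by positivity)
    obtain ⟨c, hc⟩ := exists_cosPoly_eq_eval_cos P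
    obtain ⟨c', h0, hc'⟩ := exists_cosPoly_odd_part c
    refine ⟨c', h0, fun x => ?_⟩
    rw [hc', hc, hc, Real.cos_add_pi]
    have h1 := abs_lt.1 (hP (Real.cos x) ⟨Real.neg_one_le_cos x, Real.cos_le_one x⟩)
    have h2 := abs_lt.1 (hP (-Real.cos x) ⟨neg_le_neg (Real.cos_le_one x),
      by linarith [Real.neg_one_le_cos x]⟩)
    rw [signProfile_neg] at h2
    rw [abs_le]
    constructor <;> linarith [h1.1, h1.2, h2.1, h2.2]
  choose c hc0 hc using key
  -- The factor `1 - 1 / m` in the profile leaves a margin `1 / m`; the polynomial error uses half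
  -- of it.
  have hbound : ∀ n x, |cosPoly (c n) x| ≤ 1 - 1 / (2 * ((n : ℝ) + 1)) := by
    intro n x
    have hm : (1 : ℝ) ≤ n + 1 := by simp
    have h1 := abs_le.1 (hc n x)
    have h2 := abs_le.1 (abs_signProfile_le hm (Real.abs_cos_le_one x))
    have h3 : 1 / ((n : ℝ) + 1) = 2 * (1 / (2 * ((n : ℝ) + 1))) := by field_simp
    rw [h3] at h2
    rw [abs_le]
    constructor <;> linarith [h1.1, h1.2, h2.1, h2.2]
  have hlim : Tendsto (fun n : ℕ => ∫ y, lineKernel y * cosPoly (c n) (1 / ((n : ℝ) + 1) * y))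
      atTop (𝓝 (∫ y, |lineKernel y|)) := by
    refine tendsto_integral_of_dominated_convergence (fun y => |lineKernel y|) (fun n => ?_)
      integrable_lineKernel.abs (fun n => ae_of_all _ fun y => ?_) (ae_of_all _ fun y => ?_)
    · simp_rw [cosPoly_eq_sum]
      exact (continuous_lineKernel.mul (by fun_prop)).aestronglyMeasurable
    · rw [norm_mul, Real.norm_eq_abs]
      refine mul_le_of_le_one_right (abs_nonneg _) ((hbound n _).trans ?_)
      have : 0 ≤ 1 / (2 * ((n : ℝ) + 1)) := by positivity
      linarith
    · have hdiff : Tendsto (fun n : ℕ => lineKernel y *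
          (cosPoly (c n) (1 / ((n : ℝ) + 1) * y) -
            signProfile (n + 1) (Real.cos (1 / ((n : ℝ) + 1) * y)))) atTop (𝓝 0) := by
        have hz : Tendsto (fun n : ℕ => 1 / (2 * ((n : ℝ) + 1))) atTop (𝓝 0) := by
          have := (tendsto_one_div_add_atTop_nhds_zero_nat (𝕜 := ℝ)).const_mul (1 / 2)
          rw [mul_zero] at this
          refine this.congr fun n => ?_
          field_simp
        have := (squeeze_zero_norm (fun n => hc n _) hz :
          Tendsto (fun n : ℕ => cosPoly (c n) (1 / ((n : ℝ) + 1) * y) -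
            signProfile (n + 1) (Real.cos (1 / ((n : ℝ) + 1) * y))) atTop (𝓝 0))
        simpa using this.const_mul (lineKernel y)
      have := hdiff.add (tendsto_lineKernel_mul_signProfile y)
      rw [zero_add] at this
      refine this.congr fun n => ?_
      ring
  obtain ⟨n, hn⟩ := (hlim.eventually_const_lt (sub_lt_self _ hε)).exists
  rw [integral_lineKernel_mul_cosPoly] at hn
  exact ⟨1 / ((n : ℝ) + 1), c n, 1 - 1 / (2 * ((n : ℝ) + 1)), by positivity, hc0 n,
    sub_lt_self _ (by positivity), hbound n, hn⟩

/-! ### Cosine series with summable, bounded and continuous time-dependent coefficients -/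

/-- Summable families of bounded continuous functions of time. The family `α` stands for the cosine
series `∑ k, exp (-|k|) * α k t * cos (k * x)`. -/
abbrev CosSeries := lp (fun _ : ℤ => ℝ →ᵇ ℝ) 1

namespace CosSeries

theorem summable_norm (α : CosSeries) : Summable fun k => ‖α k‖ := by
  simpa using (lp.hasSum_norm (p := 1) (by simp) α).summable

theorem norm_eq_tsum (α : CosSeries) : ‖α‖ = ∑' k, ‖α k‖ := by
  simpa using lp.norm_eq_tsum_rpow (p := 1) (by simp) α

/-- The series with prescribed coefficients. -/
def mk (u : ℤ → ℝ →ᵇ ℝ) (hu : Summable fun k => ‖u k‖) : CosSeries :=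
  ⟨u, memℓp_gen (by simpa using hu)⟩

theorem norm_apply_le (α : CosSeries) (k : ℤ) : ‖α k‖ ≤ ‖α‖ := by
  rw [norm_eq_tsum]
  exact (summable_norm α).le_tsum k fun _ _ => norm_nonneg _

theorem abs_apply_le (α : CosSeries) (k : ℤ) (t : ℝ) : |α k t| ≤ ‖α k‖ := (α k).norm_coe_le_norm t

theorem norm_term_le (α : CosSeries) (t x : ℝ) (k : ℤ) :
    ‖Real.exp (-|(k : ℝ)|) * α k t * Real.cos (k * x)‖ ≤ ‖α k‖ := by
  rw [norm_mul, norm_mul, Real.norm_eq_abs, Real.norm_eq_abs, Real.norm_eq_abs, Real.abs_exp]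
  calc _ ≤ 1 * |α k t| * 1 := by
        gcongr
        · rw [Real.exp_le_one_iff]
          simp
        · exact Real.abs_cos_le_one _
    _ ≤ _ := by simpa using (abs_apply_le α k t)

theorem summable_norm_term (α : CosSeries) (t x : ℝ) :
    Summable fun k : ℤ => ‖Real.exp (-|(k : ℝ)|) * α k t * Real.cos (k * x)‖ :=
  (summable_norm α).of_nonneg_of_le (fun _ => norm_nonneg _) (norm_term_le α t x)

/-- The value of the series at the time `t` and the point `x`. -/
def eval (t x : ℝ) : CosSeries →L[ℝ] ℝ :=
  LinearMap.mkContinuous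
    { toFun := fun α => ∑' k : ℤ, Real.exp (-|(k : ℝ)|) * α k t * Real.cos (k * x)
      map_add' := fun α β => by
        rw [← (summable_norm_term α t x).of_norm.tsum_add (summable_norm_term β t x).of_norm]
        congr 1
        funext k
        simp
        ring
      map_smul' := fun a α => by
        rw [RingHom.id_apply, smul_eq_mul, ← tsum_mul_left]
        congr 1
        funext k
        simp
        ring } 1 fun α => by
    rw [one_mul, norm_eq_tsum]
    exact (norm_tsum_le_tsum_norm (summable_norm_term α t x)).trans
      ((summable_norm_term α t x).tsum_le_tsum (norm_term_le α t x) (summable_norm α))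

theorem eval_apply (t x : ℝ) (α : CosSeries) :
    eval t x α = ∑' k : ℤ, Real.exp (-|(k : ℝ)|) * α k t * Real.cos (k * x) := rfl

theorem abs_eval_le (t x : ℝ) (α : CosSeries) : |eval t x α| ≤ ‖α‖ := by
  simpa using (LinearMap.mkContinuous_norm_le _ zero_le_one _ |> fun h =>
    (eval t x).le_of_opNorm_le h α)

theorem eval_single (t x : ℝ) (k : ℤ) (f : ℝ →ᵇ ℝ) :
    eval t x (lp.single 1 k f) = Real.exp (-|(k : ℝ)|) * f t * Real.cos (k * x) := by
  rw [eval_apply, tsum_eq_single k]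
  · simp
  · intro j hj
    rw [lp.single_apply_ne _ _ _ hj]
    simp

/-- The contribution of a pair of modes to the product of two series. -/
def mulTerm (α β : CosSeries) (p : ℤ × ℤ) : CosSeries :=
  (1 / 2 : ℝ) •
    (lp.single 1 (p.1 + p.2) (Real.exp (|((p.1 + p.2 : ℤ) : ℝ)| - |(p.1 : ℝ)| - |(p.2 : ℝ)|) •
        (α p.1 * β p.2)) +
      lp.single 1 (p.1 - p.2) (Real.exp (|((p.1 - p.2 : ℤ) : ℝ)| - |(p.1 : ℝ)| - |(p.2 : ℝ)|) •
        (α p.1 * β p.2)))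

/-- The triangle inequality `|j ± k| ≤ |j| + |k|` makes the exponential weight submultiplicative;
this is what gives a Banach algebra estimate with constant one. -/
theorem norm_mulTerm_le (α β : CosSeries) (p : ℤ × ℤ) :
    ‖mulTerm α β p‖ ≤ ‖α p.1‖ * ‖β p.2‖ := by
  have h1 : Real.exp (|((p.1 + p.2 : ℤ) : ℝ)| - |(p.1 : ℝ)| - |(p.2 : ℝ)|) ≤ 1 := by
    rw [Real.exp_le_one_iff]
    push_cast
    linarith [abs_add_le (p.1 : ℝ) p.2]
  have h2 : Real.exp (|((p.1 - p.2 : ℤ) : ℝ)| - |(p.1 : ℝ)| - |(p.2 : ℝ)|) ≤ 1 := by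
    rw [Real.exp_le_one_iff]
    push_cast
    linarith [abs_sub (p.1 : ℝ) p.2]
  have h : ∀ (j : ℤ) (a : ℝ), 0 ≤ a → a ≤ 1 →
      ‖(lp.single 1 j (a • (α p.1 * β p.2)) : CosSeries)‖ ≤ ‖α p.1‖ * ‖β p.2‖ := by
    intro j a h0 ha
    rw [lp.norm_single (by simp), norm_smul, Real.norm_eq_abs, abs_of_nonneg h0]
    exact (mul_le_of_le_one_left (norm_nonneg _) ha).trans (norm_mul_le _ _)
  rw [mulTerm, norm_smul]
  refine (mul_le_mul_of_nonneg_left (norm_add_le _ _) (norm_nonneg _)).trans ?_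
  have := h (p.1 + p.2) _ (Real.exp_pos _).le h1
  have := h (p.1 - p.2) _ (Real.exp_pos _).le h2
  rw [Real.norm_eq_abs, abs_of_nonneg (by norm_num)]
  linarith

theorem summable_norm_mulTerm (α β : CosSeries) : Summable fun p => ‖mulTerm α β p‖ :=
  ((summable_norm α).mul_of_nonneg (summable_norm β) (fun _ => norm_nonneg _)
    fun _ => norm_nonneg _).of_nonneg_of_le (fun _ => norm_nonneg _) (norm_mulTerm_le α β)

/-- The product of two series. -/
def prod (α β : CosSeries) : CosSeries := ∑' p, mulTerm α β p

theorem norm_prod_le (α β : CosSeries) : ‖prod α β‖ ≤ ‖α‖ * ‖β‖ := by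
  have hs : Summable fun p : ℤ × ℤ => ‖α p.1‖ * ‖β p.2‖ :=
    (summable_norm α).mul_of_nonneg (summable_norm β) (fun _ => norm_nonneg _) fun _ => norm_nonneg _
  calc _ ≤ ∑' p, ‖mulTerm α β p‖ := norm_tsum_le_tsum_norm (summable_norm_mulTerm α β)
    _ ≤ ∑' p : ℤ × ℤ, ‖α p.1‖ * ‖β p.2‖ :=
      (summable_norm_mulTerm α β).tsum_le_tsum (norm_mulTerm_le α β) hs
    _ = _ := by
      rw [norm_eq_tsum, norm_eq_tsum, (summable_norm α).tsum_mul_tsum (summable_norm β) hs]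

theorem prod_sub_left (α β γ : CosSeries) : prod (α - β) γ = prod α γ - prod β γ := by
  rw [prod, prod, prod, ← (summable_norm_mulTerm α γ).of_norm.tsum_sub
    (summable_norm_mulTerm β γ).of_norm]
  congr 1
  funext p
  simp only [mulTerm, lp.coeFn_sub, Pi.sub_apply, sub_mul, smul_sub, lp.single_sub]
  module

theorem prod_sub_right (α β γ : CosSeries) : prod γ (α - β) = prod γ α - prod γ β := by
  rw [prod, prod, prod, ← (summable_norm_mulTerm γ α).of_norm.tsum_sub
    (summable_norm_mulTerm γ β).of_norm]
  congr 1
  funext p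
  simp only [mulTerm, lp.coeFn_sub, Pi.sub_apply, mul_sub, smul_sub, lp.single_sub]
  module

/-- The product-to-sum formula for cosines, with the weights cancelling. -/
theorem eval_mulTerm (t x : ℝ) (α β : CosSeries) (p : ℤ × ℤ) :
    eval t x (mulTerm α β p) = Real.exp (-|(p.1 : ℝ)|) * α p.1 t * Real.cos (p.1 * x) *
      (Real.exp (-|(p.2 : ℝ)|) * β p.2 t * Real.cos (p.2 * x)) := by
  have h : ∀ a b c : ℝ, Real.exp (-a) * Real.exp (a - b - c) = Real.exp (-b) * Real.exp (-c) := by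
    intro a b c
    rw [← Real.exp_add, ← Real.exp_add]
    ring_nf
  have h1 := h |((p.1 + p.2 : ℤ) : ℝ)| |(p.1 : ℝ)| |(p.2 : ℝ)|
  have h2 := h |((p.1 - p.2 : ℤ) : ℝ)| |(p.1 : ℝ)| |(p.2 : ℝ)|
  rw [mulTerm, map_smul, map_add, eval_single, eval_single]
  simp only [BoundedContinuousFunction.coe_smul, BoundedContinuousFunction.coe_mul, Pi.mul_apply,
    smul_eq_mul]
  have e1 : Real.cos (((p.1 + p.2 : ℤ) : ℝ) * x) = Real.cos (p.1 * x) * Real.cos (p.2 * x) -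
      Real.sin (p.1 * x) * Real.sin (p.2 * x) := by
    push_cast
    rw [add_mul, Real.cos_add]
  have e2 : Real.cos (((p.1 - p.2 : ℤ) : ℝ) * x) = Real.cos (p.1 * x) * Real.cos (p.2 * x) +
      Real.sin (p.1 * x) * Real.sin (p.2 * x) := by
    push_cast
    rw [sub_mul, Real.cos_sub]
  linear_combination (1 / 2 * (α p.1 t * β p.2 t) * Real.cos (((p.1 + p.2 : ℤ) : ℝ) * x)) * h1 +
    (1 / 2 * (α p.1 t * β p.2 t) * Real.cos (((p.1 - p.2 : ℤ) : ℝ) * x)) * h2 +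
    (1 / 2 * (α p.1 t * β p.2 t) * (Real.exp (-|(p.1 : ℝ)|) * Real.exp (-|(p.2 : ℝ)|))) * (e1 + e2)

theorem eval_prod (t x : ℝ) (α β : CosSeries) :
    eval t x (prod α β) = eval t x α * eval t x β := by
  rw [prod, (eval t x).map_tsum (summable_norm_mulTerm α β).of_norm]
  simp_rw [eval_mulTerm]
  rw [eval_apply, eval_apply,
    tsum_mul_tsum_of_summable_norm (summable_norm_term α t x) (summable_norm_term β t x)]

/-- The nonlinearity `α ^ 3 - α`. -/
def cubic (α : CosSeries) : CosSeries := prod α (prod α α) - α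

theorem eval_cubic (t x : ℝ) (α : CosSeries) :
    eval t x (cubic α) = ((eval t x α) ^ 2 - 1) * eval t x α := by
  rw [cubic, map_sub, eval_prod, eval_prod]
  ring

theorem norm_cubic_le {R : ℝ} {α : CosSeries} (h : ‖α‖ ≤ R) : ‖cubic α‖ ≤ R ^ 3 + R := by
  have hR : 0 ≤ R := (norm_nonneg _).trans h
  calc _ ≤ ‖prod α (prod α α)‖ + ‖α‖ := norm_sub_le _ _
    _ ≤ ‖α‖ * (‖α‖ * ‖α‖) + ‖α‖ := by
      gcongr
      exact (norm_prod_le _ _).trans (by gcongr; exact norm_prod_le _ _)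
    _ ≤ R * (R * R) + R := by gcongr
    _ = _ := by ring

theorem norm_cubic_sub_le {R : ℝ} {α β : CosSeries} (hα : ‖α‖ ≤ R) (hβ : ‖β‖ ≤ R) :
    ‖cubic α - cubic β‖ ≤ (3 * R ^ 2 + 1) * ‖α - β‖ := by
  have hR : 0 ≤ R := (norm_nonneg _).trans hα
  -- Telescoping: one factor of the trilinear term is exchanged at a time, so commutativity and
  -- associativity of `prod` are not needed.
  have e : cubic α - cubic β = prod (α - β) (prod α α) + prod β (prod (α - β) α) +
      prod β (prod β (α - β)) - (α - β) := by
    simp only [cubic, prod_sub_left, prod_sub_right]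
    abel
  have h : ∀ a b c : CosSeries, ‖prod a (prod b c)‖ ≤ ‖a‖ * (‖b‖ * ‖c‖) := fun a b c =>
    (norm_prod_le _ _).trans (by gcongr; exact norm_prod_le _ _)
  rw [e]
  calc _ ≤ ‖α - β‖ * (‖α‖ * ‖α‖) + ‖β‖ * (‖α - β‖ * ‖α‖) + ‖β‖ * (‖β‖ * ‖α - β‖) + ‖α - β‖ := by
        refine (norm_sub_le _ _).trans ?_
        gcongr
        refine (norm_add₃_le).trans ?_
        gcongr <;> exact h _ _ _
    _ ≤ ‖α - β‖ * (R * R) + R * (‖α - β‖ * R) + R * (R * ‖α - β‖) + ‖α - β‖ := by gcongr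
    _ = _ := by ring

end CosSeries

/-! ### The Duhamel operator -/

/-- The solution of `u' = g - κ * u` with `u 0 = 0`. -/
def duhamel (κ : ℝ) (g : ℝ → ℝ) (t : ℝ) : ℝ :=
  Real.exp (-(κ * t)) * ∫ s in (0 : ℝ)..t, Real.exp (κ * s) * g s

@[simp] theorem duhamel_zero_right (κ : ℝ) (g : ℝ → ℝ) : duhamel κ g 0 = 0 := by simp [duhamel]

theorem hasDerivAt_duhamel (κ : ℝ) {g : ℝ → ℝ} (hg : Continuous g) (t : ℝ) :
    HasDerivAt (duhamel κ g) (g t - κ * duhamel κ g t) t := by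
  have h1 : HasDerivAt (fun t => ∫ s in (0 : ℝ)..t, Real.exp (κ * s) * g s)
      (Real.exp (κ * t) * g t) t :=
    ((by fun_prop : Continuous fun s => Real.exp (κ * s) * g s).integral_hasStrictDerivAt
      0 t).hasDerivAt
  have h2 : HasDerivAt (fun t => Real.exp (-(κ * t))) (Real.exp (-(κ * t)) * -(κ * 1)) t :=
    ((hasDerivAt_id t).const_mul κ).neg.exp
  refine (h2.mul h1).congr_deriv ?_
  have : Real.exp (-(κ * t)) * Real.exp (κ * t) = 1 := by rw [← Real.exp_add]; simp
  rw [duhamel]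
  linear_combination g t * this

theorem continuous_duhamel (κ : ℝ) {g : ℝ → ℝ} (hg : Continuous g) : Continuous (duhamel κ g) :=
  continuous_iff_continuousAt.2 fun t => (hasDerivAt_duhamel κ hg t).continuousAt

theorem duhamel_sub (κ : ℝ) {f g : ℝ → ℝ} (hf : Continuous f) (hg : Continuous g) (t : ℝ) :
    duhamel κ (fun s => f s - g s) t = duhamel κ f t - duhamel κ g t := by
  have h : ∀ {g : ℝ → ℝ}, Continuous g →
      IntervalIntegrable (fun s => Real.exp (κ * s) * g s) volume 0 t := fun hg =>
    Continuous.intervalIntegrable (by fun_prop) _ _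
  simp only [duhamel, mul_sub]
  rw [intervalIntegral.integral_sub (h hf) (h hg), mul_sub]

/-- Since `κ ∫₀ᵗ exp (-κ (t - s)) ds = 1 - exp (-κ t) ≤ 1`, the bound does not grow with `t`. This
makes the fixed point global in time. Undamped modes are covered, as `κ = 0` forces `σ = 0`. -/
theorem abs_mul_duhamel_le {σ κ δ M t : ℝ} {g : ℝ → ℝ} (hσ : 0 ≤ σ) (hδ : 0 ≤ δ)
    (h : σ ≤ δ * κ) (hM : ∀ s, |g s| ≤ M) (ht : 0 ≤ t) :
    |σ * duhamel κ g t| ≤ δ * M := by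
  have hM0 : 0 ≤ M := (abs_nonneg _).trans (hM 0)
  have hi : Continuous fun s => Real.exp (κ * s) := by fun_prop
  have hb : |∫ s in (0 : ℝ)..t, Real.exp (κ * s) * g s| ≤
      ∫ s in (0 : ℝ)..t, Real.exp (κ * s) * M := by
    rw [← Real.norm_eq_abs]
    refine intervalIntegral.norm_integral_le_of_norm_le (μ := volume) ht (ae_of_all _ fun s _ => ?_)
      ((hi.mul continuous_const).intervalIntegrable _ _)
    rw [norm_mul, Real.norm_eq_abs, Real.abs_exp]
    gcongr
    exact hM s
  have hpos : 0 ≤ ∫ s in (0 : ℝ)..t, Real.exp (κ * s) :=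
    intervalIntegral.integral_nonneg ht fun s _ => (Real.exp_pos _).le
  have hint : κ * ∫ s in (0 : ℝ)..t, Real.exp (κ * s) = Real.exp (κ * t) - 1 := by
    rw [← intervalIntegral.integral_const_mul,
      intervalIntegral.integral_eq_sub_of_hasDerivAt (f := fun s => Real.exp (κ * s))]
    · simp
    · intro s _
      convert! ((hasDerivAt_id s).const_mul κ).exp using 1
      simp [mul_comm]
    · exact (by fun_prop : Continuous fun s => κ * Real.exp (κ * s)).intervalIntegrable _ _
  rw [intervalIntegral.integral_mul_const] at hb
  rw [duhamel, abs_mul, abs_mul, abs_of_nonneg hσ, Real.abs_exp]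
  calc σ * (Real.exp (-(κ * t)) * |∫ s in (0 : ℝ)..t, Real.exp (κ * s) * g s|)
      ≤ δ * κ * (Real.exp (-(κ * t)) * ((∫ s in (0 : ℝ)..t, Real.exp (κ * s)) * M)) := by
        gcongr
        exact hσ.trans h
    _ = δ * M * (Real.exp (-(κ * t)) * (κ * ∫ s in (0 : ℝ)..t, Real.exp (κ * s))) := by ring
    _ = δ * M * (1 - Real.exp (-(κ * t))) := by
        rw [hint, mul_sub, ← Real.exp_add]
        simp
    _ ≤ δ * M := mul_le_of_le_one_right (by positivity) (by linarith [Real.exp_pos (-(κ * t))])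

/-- The operator `g ↦ σ * duhamel κ g` on bounded continuous functions, extended to negative times
by its value `0` at the time `0`. -/
def duhamelBCF (σ κ δ : ℝ) (hσ : 0 ≤ σ) (hδ : 0 ≤ δ) (h : σ ≤ δ * κ) (g : ℝ →ᵇ ℝ) : ℝ →ᵇ ℝ :=
  BoundedContinuousFunction.ofNormedAddCommGroup (fun t => σ * duhamel κ g (max t 0))
    (continuous_const.mul ((continuous_duhamel κ g.continuous).comp
      (continuous_id.max continuous_const))) (δ * ‖g‖)
    fun _ => abs_mul_duhamel_le hσ hδ h (fun s => g.norm_coe_le_norm s) (le_max_right _ _)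

theorem norm_duhamelBCF_le (σ κ δ : ℝ) (hσ : 0 ≤ σ) (hδ : 0 ≤ δ) (h : σ ≤ δ * κ) (g : ℝ →ᵇ ℝ) :
    ‖duhamelBCF σ κ δ hσ hδ h g‖ ≤ δ * ‖g‖ :=
  BoundedContinuousFunction.norm_ofNormedAddCommGroup_le _ (by positivity) _

theorem duhamelBCF_sub (σ κ δ : ℝ) (hσ : 0 ≤ σ) (hδ : 0 ≤ δ) (h : σ ≤ δ * κ) (f g : ℝ →ᵇ ℝ) :
    duhamelBCF σ κ δ hσ hδ h (f - g) =
      duhamelBCF σ κ δ hσ hδ h f - duhamelBCF σ κ δ hσ hδ h g := by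
  ext t
  have := duhamel_sub κ f.continuous g.continuous (max t 0)
  simp only [duhamelBCF, BoundedContinuousFunction.coe_ofNormedAddCommGroup,
    BoundedContinuousFunction.coe_sub, Pi.sub_apply]
  rw [← mul_sub, ← this]
  rfl

namespace CosSeries

/-- The operator that acts on the `k`-th mode as `g ↦ σ k * duhamel (κ k) g`. -/
def duhamelOp (σ κ : ℤ → ℝ) (δ : ℝ) (hσ : ∀ k, 0 ≤ σ k) (hδ : 0 ≤ δ) (h : ∀ k, σ k ≤ δ * κ k)
    (α : CosSeries) : CosSeries :=
  mk (fun k => duhamelBCF (σ k) (κ k) δ (hσ k) hδ (h k) (α k))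
    (((summable_norm α).mul_left δ).of_nonneg_of_le (fun _ => norm_nonneg _)
      fun _ => norm_duhamelBCF_le _ _ _ _ _ _ _)

theorem norm_duhamelOp_le (σ κ : ℤ → ℝ) (δ : ℝ) (hσ : ∀ k, 0 ≤ σ k) (hδ : 0 ≤ δ)
    (h : ∀ k, σ k ≤ δ * κ k) (α : CosSeries) : ‖duhamelOp σ κ δ hσ hδ h α‖ ≤ δ * ‖α‖ := by
  rw [norm_eq_tsum, norm_eq_tsum, ← tsum_mul_left]
  exact (summable_norm _).tsum_le_tsum (fun k => norm_duhamelBCF_le _ _ _ (hσ k) hδ (h k) _)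
    ((summable_norm α).mul_left δ)

theorem duhamelOp_sub (σ κ : ℤ → ℝ) (δ : ℝ) (hσ : ∀ k, 0 ≤ σ k) (hδ : 0 ≤ δ)
    (h : ∀ k, σ k ≤ δ * κ k) (α β : CosSeries) :
    duhamelOp σ κ δ hσ hδ h (α - β) = duhamelOp σ κ δ hσ hδ h α - duhamelOp σ κ δ hσ hδ h β := by
  ext1
  funext k
  exact duhamelBCF_sub (σ k) (κ k) δ (hσ k) hδ (h k) (α k) (β k)

/-- The weighted `ℓ¹` norm of a cosine polynomial. -/
def weightedNorm (c : ℤ →₀ ℝ) : ℝ := ∑ k ∈ c.support, Real.exp |(k : ℝ)| * |c k|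

/-- The mode `a * exp (-(κ * max t 0))` of a linear evolution. -/
def linearMode (κ a : ℝ) (hκ : 0 ≤ κ) : ℝ →ᵇ ℝ :=
  BoundedContinuousFunction.ofNormedAddCommGroup (fun t => a * Real.exp (-(κ * max t 0)))
    (by fun_prop) |a| fun t => by
      rw [norm_mul, Real.norm_eq_abs, Real.norm_eq_abs, Real.abs_exp]
      refine mul_le_of_le_one_right (abs_nonneg _) (Real.exp_le_one_iff.2 ?_)
      have : 0 ≤ κ * max t 0 := mul_nonneg hκ (le_max_right _ _)
      linarith

theorem norm_linearMode_le (κ a : ℝ) (hκ : 0 ≤ κ) : ‖linearMode κ a hκ‖ ≤ |a| :=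
  BoundedContinuousFunction.norm_ofNormedAddCommGroup_le _ (abs_nonneg _) _

theorem hasSum_weightedNorm (c : ℤ →₀ ℝ) :
    HasSum (fun k : ℤ => |Real.exp |(k : ℝ)| * c k|) (weightedNorm c) := by
  have : weightedNorm c = ∑ k ∈ c.support, |Real.exp |(k : ℝ)| * c k| := by
    simp [weightedNorm, abs_mul]
  rw [this]
  refine hasSum_sum_of_ne_finset_zero fun k hk => ?_
  simp [Finsupp.notMem_support_iff.1 hk]

/-- The linear evolution with initial value `cosPoly c` and damping rates `κ`. -/
def linearEvolution (κ : ℤ → ℝ) (hκ : ∀ k, 0 ≤ κ k) (c : ℤ →₀ ℝ) : CosSeries :=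
  mk (fun k => linearMode (κ k) (Real.exp |(k : ℝ)| * c k) (hκ k))
    ((hasSum_weightedNorm c).summable.of_nonneg_of_le (fun _ => norm_nonneg _)
      fun _ => norm_linearMode_le _ _ _)

theorem norm_linearEvolution_le (κ : ℤ → ℝ) (hκ : ∀ k, 0 ≤ κ k) (c : ℤ →₀ ℝ) :
    ‖linearEvolution κ hκ c‖ ≤ weightedNorm c := by
  rw [norm_eq_tsum, ← (hasSum_weightedNorm c).tsum_eq]
  exact (summable_norm _).tsum_le_tsum (fun k => norm_linearMode_le _ _ (hκ k))
    (hasSum_weightedNorm c).summable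

theorem linearEvolution_apply (κ : ℤ → ℝ) (hκ : ∀ k, 0 ≤ κ k) (c : ℤ →₀ ℝ) (k : ℤ) {t : ℝ}
    (ht : 0 ≤ t) :
    linearEvolution κ hκ c k t = Real.exp |(k : ℝ)| * c k * Real.exp (-(κ k * t)) := by
  change Real.exp |(k : ℝ)| * c k * Real.exp (-(κ k * max t 0)) = _
  rw [max_eq_left ht]

theorem eval_linearEvolution (κ : ℤ → ℝ) (hκ : ∀ k, 0 ≤ κ k) (c : ℤ →₀ ℝ) {t : ℝ} (ht : 0 ≤ t)
    (x : ℝ) : eval t x (linearEvolution κ hκ c) =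
      ∑ k ∈ c.support, c k * Real.exp (-(κ k * t)) * Real.cos (k * x) := by
  rw [eval_apply]
  simp_rw [linearEvolution_apply κ hκ c _ ht]
  rw [tsum_eq_sum (s := c.support) fun k hk => by simp [Finsupp.notMem_support_iff.1 hk]]
  refine Finset.sum_congr rfl fun k _ => ?_
  have : Real.exp (-|(k : ℝ)|) * Real.exp |(k : ℝ)| = 1 := by rw [← Real.exp_add]; simp
  linear_combination (c k * Real.exp (-(κ k * t)) * Real.cos (k * x)) * this

/-- Existence of mild solutions for weak nonlinearities. -/
theorem exists_mild_solution (σ κ : ℤ → ℝ) {δ : ℝ} (hσ : ∀ k, 0 ≤ σ k) (hδ : 0 ≤ δ)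
    (h : ∀ k, σ k ≤ δ * κ k) (hκ : ∀ k, 0 ≤ κ k) (c : ℤ →₀ ℝ) {R : ℝ}
    (hR : weightedNorm c + δ * (R ^ 3 + R) ≤ R) (hδR : δ * (3 * R ^ 2 + 1) ≤ 1 / 2) :
    ∃ α : CosSeries, ‖α - linearEvolution κ hκ c‖ ≤ δ * (R ^ 3 + R) ∧
      ∀ k t, 0 ≤ t → α k t = Real.exp |(k : ℝ)| * c k * Real.exp (-(κ k * t)) -
        σ k * duhamel (κ k) (cubic α k) t := by
  set L := linearEvolution κ hκ c
  set D := duhamelOp σ κ δ hσ hδ h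
  have hD := norm_duhamelOp_le σ κ δ hσ hδ h
  set Ψ : CosSeries → CosSeries := fun α => L - D (cubic α) with hΨ
  set B : Set CosSeries := Metric.closedBall 0 R
  have hball : ∀ α ∈ B, ‖Ψ α - L‖ ≤ δ * (R ^ 3 + R) := by
    intro α hα
    have hα' : ‖α‖ ≤ R := by simpa [B] using hα
    have : Ψ α - L = -D (cubic α) := by simp [hΨ]
    rw [this, norm_neg]
    exact (hD _).trans (by gcongr; exact norm_cubic_le hα')
  have hw : ‖L‖ ≤ weightedNorm c := norm_linearEvolution_le κ hκ c
  have hmaps : Set.MapsTo Ψ B B := by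
    intro α hα
    have h1 : ‖Ψ α‖ ≤ ‖Ψ α - L‖ + ‖L‖ := by simpa using norm_add_le (Ψ α - L) L
    have h2 := hball α hα
    simp only [B, mem_closedBall_zero_iff]
    linarith
  have hcon : ContractingWith (1 / 2) (hmaps.restrict Ψ B B) := by
    refine ⟨by rw [← NNReal.coe_lt_coe]; norm_num, LipschitzWith.of_dist_le_mul fun a b => ?_⟩
    have ha : ‖(a : CosSeries)‖ ≤ R := mem_closedBall_zero_iff.1 a.2
    have hb : ‖(b : CosSeries)‖ ≤ R := mem_closedBall_zero_iff.1 b.2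
    have e : Ψ a - Ψ b = -D (cubic a - cubic b) := by
      have := duhamelOp_sub σ κ δ hσ hδ h (cubic a) (cubic b)
      simp only [hΨ, D, this]
      abel
    rw [Subtype.dist_eq, Subtype.dist_eq, Set.MapsTo.val_restrict_apply,
      Set.MapsTo.val_restrict_apply, dist_eq_norm, dist_eq_norm, e, norm_neg]
    calc _ ≤ δ * ‖cubic a - cubic b‖ := hD _
      _ ≤ δ * ((3 * R ^ 2 + 1) * ‖(a : CosSeries) - b‖) := by
        gcongr
        exact norm_cubic_sub_le ha hb
      _ = δ * (3 * R ^ 2 + 1) * ‖(a : CosSeries) - b‖ := by ring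
      _ ≤ 1 / 2 * ‖(a : CosSeries) - b‖ := by gcongr
      _ = _ := by simp
  -- If `R < 0`, the smallness of `δ` gives `δ (R³ + R) ≥ R / 2 > R`, against `hR`.
  have hR0 : 0 ≤ R := by
    by_contra! hneg
    have h0 : 0 ≤ weightedNorm c := (norm_nonneg _).trans hw
    nlinarith [mul_nonneg hδ (sq_nonneg R)]
  have hL : L ∈ B := by
    simp only [B, mem_closedBall_zero_iff]
    have : 0 ≤ δ * (R ^ 3 + R) := by positivity
    linarith
  obtain ⟨α, hα, hfix, -⟩ := hcon.exists_fixedPoint' Metric.isClosed_closedBall.isComplete hmaps hL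
    (edist_ne_top _ _)
  refine ⟨α, ?_, fun k t ht => ?_⟩
  · have := hball α hα
    rwa [hfix] at this
  · have e : α k t = Ψ α k t := by rw [hfix]
    rw [e, hΨ]
    change L k t - σ k * duhamel (κ k) (cubic α k) (max t 0) = _
    rw [linearEvolution_apply κ hκ c k ht, max_eq_left ht]

end CosSeries

/-! ### Partial derivatives -/

section PartialDerivatives

variable {d : ℕ}

/-- The partial derivative in the `i`-th coordinate. -/
def partialDeriv (i : Fin d) (g : EuclideanSpace ℝ (Fin d) → ℝ) (x : EuclideanSpace ℝ (Fin d)) :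
    ℝ :=
  fderiv ℝ g x (EuclideanSpace.single i 1)

variable {f g : EuclideanSpace ℝ (Fin d) → ℝ}

theorem contDiff_partialDeriv (hg : ContDiff ℝ ∞ g) (i : Fin d) :
    ContDiff ℝ ∞ (partialDeriv i g) :=
  (hg.fderiv_right (m := ∞) (by simp)).clm_apply contDiff_const

theorem differentiable_of_smooth (hg : ContDiff ℝ ∞ g) : Differentiable ℝ g :=
  hg.differentiable (by simp)

theorem isPeriodic_partialDeriv (hg : IsPeriodic g) (i : Fin d) :
    IsPeriodic (partialDeriv i g) := by
  intro j x
  have h : (fun y => g (y + EuclideanSpace.single j (2 * Real.pi))) = g := funext (hg j)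
  rw [partialDeriv, ← fderiv_comp_add_right, h, partialDeriv]

theorem partialDeriv_add (hf : ContDiff ℝ ∞ f) (hg : ContDiff ℝ ∞ g) (i : Fin d)
    (x : EuclideanSpace ℝ (Fin d)) :
    partialDeriv i (fun y => f y + g y) x = partialDeriv i f x + partialDeriv i g x := by
  simp [partialDeriv, fderiv_fun_add (differentiable_of_smooth hf x) (differentiable_of_smooth hg x)]

theorem partialDeriv_sub (hf : ContDiff ℝ ∞ f) (hg : ContDiff ℝ ∞ g) (i : Fin d)
    (x : EuclideanSpace ℝ (Fin d)) :
    partialDeriv i (fun y => f y - g y) x = partialDeriv i f x - partialDeriv i g x := by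
  simp [partialDeriv, fderiv_fun_sub (differentiable_of_smooth hf x) (differentiable_of_smooth hg x)]

theorem partialDeriv_mul (hf : ContDiff ℝ ∞ f) (hg : ContDiff ℝ ∞ g) (i : Fin d)
    (x : EuclideanSpace ℝ (Fin d)) :
    partialDeriv i (fun y => f y * g y) x = f x * partialDeriv i g x + partialDeriv i f x * g x := by
  simp [partialDeriv, fderiv_fun_mul (differentiable_of_smooth hf x) (differentiable_of_smooth hg x)]
  ring

theorem partialDeriv_const_mul (hf : ContDiff ℝ ∞ f) (a : ℝ) (i : Fin d)
    (x : EuclideanSpace ℝ (Fin d)) :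
    partialDeriv i (fun y => a * f y) x = a * partialDeriv i f x := by
  simp [partialDeriv, fderiv_const_mul (differentiable_of_smooth hf x)]

theorem partialDeriv_sum {ι : Type*} (s : Finset ι) {F : ι → EuclideanSpace ℝ (Fin d) → ℝ}
    (hF : ∀ j ∈ s, ContDiff ℝ ∞ (F j)) (i : Fin d) (x : EuclideanSpace ℝ (Fin d)) :
    partialDeriv i (fun y => ∑ j ∈ s, F j y) x = ∑ j ∈ s, partialDeriv i (F j) x := by
  simp [partialDeriv, fderiv_fun_sum fun j hj => differentiable_of_smooth (hF j hj) x]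

theorem gradient_apply (g : EuclideanSpace ℝ (Fin d) → ℝ) (x : EuclideanSpace ℝ (Fin d))
    (i : Fin d) : gradient g x i = partialDeriv i g x := by
  rw [partialDeriv, ← inner_gradient_left, EuclideanSpace.inner_single_right]
  simp

theorem norm_gradient_sq (g : EuclideanSpace ℝ (Fin d) → ℝ) (x : EuclideanSpace ℝ (Fin d)) :
    ‖gradient g x‖ ^ 2 = ∑ i, partialDeriv i g x ^ 2 := by
  rw [EuclideanSpace.norm_sq_eq]
  simp [gradient_apply]

/-- The Laplacian as the sum of the pure second partial derivatives. -/
def lap (g : EuclideanSpace ℝ (Fin d) → ℝ) (x : EuclideanSpace ℝ (Fin d)) : ℝ :=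
  ∑ i, partialDeriv i (partialDeriv i g) x

theorem contDiff_lap (hg : ContDiff ℝ ∞ g) : ContDiff ℝ ∞ (lap g) :=
  ContDiff.sum fun i _ => contDiff_partialDeriv (contDiff_partialDeriv hg i) i

theorem isPeriodic_lap (hg : IsPeriodic g) : IsPeriodic (lap g) := by
  intro j x
  simp only [lap]
  exact Finset.sum_congr rfl fun i _ =>
    isPeriodic_partialDeriv (isPeriodic_partialDeriv hg i) i j x

theorem laplacian_eq_lap (hg : ContDiff ℝ ∞ g) : Laplacian.laplacian g = lap g := by
  rw [InnerProductSpace.laplacian_eq_iteratedFDeriv_orthonormalBasis g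
    (EuclideanSpace.basisFun (Fin d) ℝ)]
  funext x
  refine Finset.sum_congr rfl fun i _ => ?_
  have h : DifferentiableAt ℝ (fderiv ℝ g) x :=
    (hg.fderiv_right (m := ∞) (by simp)).differentiable (by simp) x
  rw [iteratedFDeriv_two_apply, partialDeriv]
  unfold partialDeriv
  rw [fderiv_clm_apply h (differentiableAt_const _)]
  simp

theorem lap_sub (hf : ContDiff ℝ ∞ f) (hg : ContDiff ℝ ∞ g) (x : EuclideanSpace ℝ (Fin d)) :
    lap (fun y => f y - g y) x = lap f x - lap g x := by
  rw [lap, lap, lap, ← Finset.sum_sub_distrib]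
  refine Finset.sum_congr rfl fun i _ => ?_
  rw [funext (partialDeriv_sub hf hg i), partialDeriv_sub (contDiff_partialDeriv hf i)
    (contDiff_partialDeriv hg i)]

/-- The components of the flux `(|∇g|² - 1) ∇g`. -/
def flux (g : EuclideanSpace ℝ (Fin d) → ℝ) (i : Fin d) (x : EuclideanSpace ℝ (Fin d)) : ℝ :=
  (∑ j, partialDeriv j g x ^ 2 - 1) * partialDeriv i g x

theorem contDiff_flux (hg : ContDiff ℝ ∞ g) (i : Fin d) : ContDiff ℝ ∞ (flux g i) :=
  ((ContDiff.sum fun j _ => (contDiff_partialDeriv hg j).pow 2).sub contDiff_const).mul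
    (contDiff_partialDeriv hg i)

theorem isPeriodic_flux (hg : IsPeriodic g) (i : Fin d) : IsPeriodic (flux g i) := by
  intro j x
  simp only [flux, isPeriodic_partialDeriv hg _ j x]

theorem rhs_eq (hg : ContDiff ℝ ∞ g) (ν : ℝ) (x : EuclideanSpace ℝ (Fin d)) :
    rhs ν g x = ∑ i, partialDeriv i (flux g i) x - ν * lap (lap g) x := by
  rw [rhs, laplacian_eq_lap hg, laplacian_eq_lap (contDiff_lap hg), divergence]
  congr 1
  refine Finset.sum_congr rfl fun i _ => ?_
  have : (fun y => ((‖gradient g y‖ ^ 2 - 1) • gradient g y) i) = flux g i := by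
    funext y
    rw [PiLp.smul_apply, norm_gradient_sq, gradient_apply, flux, smul_eq_mul]
  rw [this, partialDeriv]

theorem partialDeriv_flux (hg : ContDiff ℝ ∞ g) (i : Fin d) (x : EuclideanSpace ℝ (Fin d)) :
    partialDeriv i (flux g i) x =
      (∑ j, partialDeriv j g x ^ 2 - 1) * partialDeriv i (partialDeriv i g) x +
        (∑ j, 2 * (partialDeriv j g x * partialDeriv i (partialDeriv j g) x)) *
          partialDeriv i g x := by
  have h : ∀ j, ContDiff ℝ ∞ (partialDeriv j g) := contDiff_partialDeriv hg
  unfold flux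
  rw [partialDeriv_mul ((ContDiff.sum fun j _ => (h j).pow 2).sub contDiff_const) (h i),
    partialDeriv_sub (ContDiff.sum fun j _ => (h j).pow 2) contDiff_const,
    partialDeriv_sum _ fun j _ => (h j).pow 2]
  have h2 : ∀ j, partialDeriv i (fun y => partialDeriv j g y ^ 2) x =
      2 * (partialDeriv j g x * partialDeriv i (partialDeriv j g) x) := by
    intro j
    simp_rw [pow_two]
    rw [partialDeriv_mul (h j) (h j)]
    ring
  have h3 : partialDeriv i (fun _ => (1 : ℝ)) x = 0 := by simp [partialDeriv]
  simp_rw [h2]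
  rw [h3, sub_zero]

theorem lap_lap (hg : ContDiff ℝ ∞ g) (x : EuclideanSpace ℝ (Fin d)) :
    lap (lap g) x =
      ∑ i, ∑ j, partialDeriv i (partialDeriv i (partialDeriv j (partialDeriv j g))) x := by
  have h : ∀ j, ContDiff ℝ ∞ (partialDeriv j (partialDeriv j g)) := fun j =>
    contDiff_partialDeriv (contDiff_partialDeriv hg j) j
  rw [lap]
  refine Finset.sum_congr rfl fun i _ => ?_
  have e : partialDeriv i (lap g) =
      fun y => ∑ j, partialDeriv i (partialDeriv j (partialDeriv j g)) y :=
    funext fun y => partialDeriv_sum _ (fun j _ => h j) i y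
  rw [e, partialDeriv_sum _ fun j _ => contDiff_partialDeriv (h j) i]

end PartialDerivatives

/-! ### Functions of one coordinate -/

theorem partialDeriv_comp_coord {d : ℕ} {G : ℝ → ℝ} (hG : Differentiable ℝ G) (i₀ i : Fin d)
    (x : EuclideanSpace ℝ (Fin d)) :
    partialDeriv i (fun y : EuclideanSpace ℝ (Fin d) => G (y i₀)) x =
      if i = i₀ then deriv G (x i₀) else 0 := by
  have h1 : HasFDerivAt (fun y : EuclideanSpace ℝ (Fin d) => y i₀)
      (EuclideanSpace.proj i₀ : EuclideanSpace ℝ (Fin d) →L[ℝ] ℝ) x :=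
    (EuclideanSpace.proj i₀ : EuclideanSpace ℝ (Fin d) →L[ℝ] ℝ).hasFDerivAt
  have h2 := (hG (x i₀)).hasDerivAt.comp_hasFDerivAt x h1
  have h3 : HasFDerivAt (fun y : EuclideanSpace ℝ (Fin d) => G (y i₀))
    (deriv G (x i₀) • (EuclideanSpace.proj i₀ : EuclideanSpace ℝ (Fin d) →L[ℝ] ℝ)) x := h2
  rw [partialDeriv, h3.fderiv]
  simp [eq_comm]

theorem sum_partialDeriv_comp_coord {d : ℕ} {G : ℝ → ℝ} (hG : Differentiable ℝ G) (i₀ : Fin d)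
    (x : EuclideanSpace ℝ (Fin d)) (m : ℕ) (hm : m ≠ 0) :
    ∑ i, partialDeriv i (fun y : EuclideanSpace ℝ (Fin d) => G (y i₀)) x ^ m =
      deriv G (x i₀) ^ m := by
  simp [partialDeriv_comp_coord hG, ite_pow, hm]

theorem lap_comp_coord {d : ℕ} {G : ℝ → ℝ} (hG : ContDiff ℝ ∞ G) (i₀ : Fin d) :
    lap (fun y : EuclideanSpace ℝ (Fin d) => G (y i₀)) = fun y => deriv (deriv G) (y i₀) := by
  have hd : Differentiable ℝ G := hG.differentiable (by simp)
  have hd' : Differentiable ℝ (deriv G) :=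
    (contDiff_infty_iff_deriv.1 hG).2.differentiable (by simp)
  funext x
  rw [lap, Finset.sum_eq_single i₀]
  · have : partialDeriv i₀ (fun y : EuclideanSpace ℝ (Fin d) => G (y i₀)) =
        fun y => deriv G (y i₀) := by
      funext y
      simp [partialDeriv_comp_coord hd]
    rw [this]
    simp [partialDeriv_comp_coord hd']
  · intro i _ hi
    have : partialDeriv i (fun y : EuclideanSpace ℝ (Fin d) => G (y i₀)) = fun _ => 0 := by
      funext y
      simp [partialDeriv_comp_coord hd, hi]
    rw [this]
    simp [partialDeriv]
  · simp

theorem contDiff_comp_coord {d : ℕ} {G : ℝ → ℝ} (hG : ContDiff ℝ ∞ G) (i₀ : Fin d) :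
    ContDiff ℝ ∞ fun y : EuclideanSpace ℝ (Fin d) => G (y i₀) :=
  hG.comp (EuclideanSpace.proj i₀ : EuclideanSpace ℝ (Fin d) →L[ℝ] ℝ).contDiff

theorem norm_gradient_comp_coord {d : ℕ} {G : ℝ → ℝ} (hG : Differentiable ℝ G) (i₀ : Fin d)
    (x : EuclideanSpace ℝ (Fin d)) :
    ‖gradient (fun y : EuclideanSpace ℝ (Fin d) => G (y i₀)) x‖ = |deriv G (x i₀)| := by
  rw [← sq_eq_sq₀ (norm_nonneg _) (abs_nonneg _), norm_gradient_sq,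
    sum_partialDeriv_comp_coord hG i₀ x 2 two_ne_zero, sq_abs]

theorem rhs_comp_coord {d : ℕ} {G : ℝ → ℝ} (hG : ContDiff ℝ ∞ G) (i₀ : Fin d) (ν : ℝ)
    (x : EuclideanSpace ℝ (Fin d)) :
    rhs ν (fun y : EuclideanSpace ℝ (Fin d) => G (y i₀)) x =
      deriv (fun s => (deriv G s ^ 2 - 1) * deriv G s) (x i₀) -
        ν * deriv (deriv (deriv (deriv G))) (x i₀) := by
  have hd : Differentiable ℝ G := hG.differentiable (by simp)
  have hG' : ContDiff ℝ ∞ (deriv G) := (contDiff_infty_iff_deriv.1 hG).2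
  have hG'' : ContDiff ℝ ∞ (deriv (deriv G)) := (contDiff_infty_iff_deriv.1 hG').2
  have hF : Differentiable ℝ fun s => (deriv G s ^ 2 - 1) * deriv G s :=
    (((hG'.pow 2).sub contDiff_const).mul hG').differentiable (by simp)
  rw [rhs_eq (contDiff_comp_coord hG i₀), lap_comp_coord hG, lap_comp_coord hG'',
    Finset.sum_eq_single i₀]
  · have : flux (fun y : EuclideanSpace ℝ (Fin d) => G (y i₀)) i₀ =
        fun y => (fun s => (deriv G s ^ 2 - 1) * deriv G s) (y i₀) := by
      funext y
      rw [flux, sum_partialDeriv_comp_coord hd i₀ y 2 two_ne_zero, partialDeriv_comp_coord hd,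
        if_pos rfl]
    rw [this, partialDeriv_comp_coord hF, if_pos rfl]
  · intro i _ hi
    have : flux (fun y : EuclideanSpace ℝ (Fin d) => G (y i₀)) i = fun _ => 0 := by
      funext y
      rw [flux, partialDeriv_comp_coord hd, if_neg hi, mul_zero]
    rw [this]
    simp [partialDeriv]
  · simp

/-! ### Integration over the torus -/

section TorusIntegral

variable {d : ℕ}

/-- The closed cell `[0, 2π]^d`. -/
def closedCell (d : ℕ) : Set (EuclideanSpace ℝ (Fin d)) :=
  {x | ∀ i, x i ∈ Set.Icc 0 (2 * Real.pi)}

theorem isCompact_closedCell : IsCompact (closedCell d) := by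
  have h : IsCompact (Set.Icc (fun _ : Fin d => (0 : ℝ)) fun _ => 2 * Real.pi) := isCompact_Icc
  have := h.image (PiLp.continuous_toLp 2 fun _ : Fin d => ℝ)
  convert! this using 1
  ext x
  simp only [closedCell, Set.mem_ofPred_eq, Set.mem_image, Set.mem_Icc, Pi.le_def]
  constructor
  · intro hx
    exact ⟨x.ofLp, ⟨fun i => (hx i).1, fun i => (hx i).2⟩, rfl⟩
  · rintro ⟨y, ⟨h1, h2⟩, rfl⟩ i
    exact ⟨h1 i, h2 i⟩

theorem integrableOn_cell {g : EuclideanSpace ℝ (Fin d) → ℝ} (hg : Continuous g) :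
    IntegrableOn g {x : EuclideanSpace ℝ (Fin d) | ∀ i, x i ∈ Set.Ico 0 (2 * Real.pi)} :=
  (hg.continuousOn.integrableOn_compact isCompact_closedCell).mono_set
    fun _ hx i => Set.Ico_subset_Icc_self (hx i)

theorem torusIntegral_eq_integral_Icc (g : EuclideanSpace ℝ (Fin d) → ℝ) :
    torusIntegral g = ∫ y in Set.Icc (fun _ : Fin d => (0 : ℝ)) fun _ => 2 * Real.pi,
      g (WithLp.toLp 2 y) := by
  have h := (PiLp.volume_preserving_toLp (Fin d)).setIntegral_preimage_emb
    (MeasurableEquiv.toLp 2 (Fin d → ℝ)).measurableEmbedding g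
    {x : EuclideanSpace ℝ (Fin d) | ∀ i, x i ∈ Set.Ico 0 (2 * Real.pi)}
  rw [torusIntegral, ← h]
  have e : WithLp.toLp 2 ⁻¹' {x : EuclideanSpace ℝ (Fin d) | ∀ i, x i ∈ Set.Ico 0 (2 * Real.pi)} =
      Set.univ.pi fun _ : Fin d => Set.Ico 0 (2 * Real.pi) := by
    ext y
    simp
  rw [e]
  exact setIntegral_congr_set Measure.univ_pi_Ico_ae_eq_Icc

/-- The divergence theorem on the box: opposite faces differ by a period, so their contributions
cancel. -/
theorem torusIntegral_sum_partialDeriv (V : Fin d → EuclideanSpace ℝ (Fin d) → ℝ)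
    (hV : ∀ i, ContDiff ℝ ∞ (V i)) (hp : ∀ i, IsPeriodic (V i)) :
    torusIntegral (fun x => ∑ i, partialDeriv i (V i) x) = 0 := by
  cases d with
  | zero => simp [torusIntegral]
  | succ n =>
    set L : (Fin (n + 1) → ℝ) →L[ℝ] EuclideanSpace ℝ (Fin (n + 1)) :=
      (EuclideanSpace.equiv (Fin (n + 1)) ℝ).symm.toContinuousLinearMap
    have hL : ∀ y, L y = WithLp.toLp 2 y := fun _ => rfl
    have hcont : ∀ i, Continuous (partialDeriv i (V i)) := fun i =>
      (contDiff_partialDeriv (hV i) i).continuous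
    have h := integral_divergence_of_hasFDerivAt_off_countable'
      (fun _ : Fin (n + 1) => (0 : ℝ)) (fun _ => 2 * Real.pi) (fun _ => by positivity)
      (fun i y => V i (L y)) (fun i y => (fderiv ℝ (V i) (L y)).comp L) ∅ Set.countable_empty
      (fun i => ((hV i).continuous.comp L.continuous).continuousOn)
      (fun y _ i => (differentiable_of_smooth (hV i) (L y)).hasFDerivAt.comp y L.hasFDerivAt)
      (by
        have : Continuous fun y => ∑ i, ((fderiv ℝ (V i) (L y)).comp L) (Pi.single i 1) :=
          continuous_finsetSum _ fun i _ => (hcont i).comp L.continuous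
        exact this.continuousOn.integrableOn_compact isCompact_Icc)
    rw [torusIntegral_eq_integral_Icc]
    refine h.trans (Finset.sum_eq_zero fun i _ => ?_)
    rw [sub_eq_zero]
    congr 1
    funext y
    have e : L (i.insertNth (2 * Real.pi) y) =
        L (i.insertNth 0 y) + EuclideanSpace.single i (2 * Real.pi) := by
      ext j
      rcases Fin.eq_self_or_eq_succAbove i j with rfl | ⟨j, rfl⟩
      · simp [hL]
      · simp [hL]
    rw [e, hp i]

end TorusIntegral

/-! ### Uniqueness of smooth solutions -/

section Uniqueness

variable {d : ℕ}

/-- Families in `C([0, T); C^∞)`. -/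
def IsSmoothFamily (T : ℝ) (g : ℝ → EuclideanSpace ℝ (Fin d) → ℝ) : Prop :=
  (∀ t ∈ Set.Ico 0 T, ContDiff ℝ ∞ (g t)) ∧
    ∀ k : ℕ, ContinuousOn (fun p : ℝ × EuclideanSpace ℝ (Fin d) => iteratedFDeriv ℝ k (g p.1) p.2)
      (Set.Ico 0 T ×ˢ Set.univ)

theorem IsSmoothFamily.continuousOn {T : ℝ} {g : ℝ → EuclideanSpace ℝ (Fin d) → ℝ}
    (hg : IsSmoothFamily T g) :
    ContinuousOn (fun p : ℝ × EuclideanSpace ℝ (Fin d) => g p.1 p.2)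
      (Set.Ico 0 T ×ˢ Set.univ) := by
  have := (ContinuousMultilinearMap.apply ℝ (fun _ : Fin 0 => EuclideanSpace ℝ (Fin d)) ℝ
    (fun _ => 0)).continuous.comp_continuousOn (hg.2 0)
  exact this.congr fun p _ => by simp

theorem IsSmoothFamily.pderiv {T : ℝ} {g : ℝ → EuclideanSpace ℝ (Fin d) → ℝ}
    (hg : IsSmoothFamily T g) (i : Fin d) :
    IsSmoothFamily T fun t => partialDeriv i (g t) := by
  refine ⟨fun t ht => contDiff_partialDeriv (hg.1 t ht) i, fun k => ?_⟩
  set A : (EuclideanSpace ℝ (Fin d) →L[ℝ] ℝ) →L[ℝ] ℝ :=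
    ContinuousLinearMap.apply ℝ ℝ (EuclideanSpace.single i (1 : ℝ))
  -- The `k`-th derivative of a partial derivative is the derivative of order `k + 1` with its last
  -- slot evaluated at a basis vector, a continuous linear operation.
  have h := (ContinuousLinearMap.compContinuousMultilinearMapL ℝ
    (fun _ : Fin k => EuclideanSpace ℝ (Fin d)) (EuclideanSpace ℝ (Fin d) →L[ℝ] ℝ) ℝ
      A).continuous.comp_continuousOn
    ((continuousMultilinearCurryRightEquiv' ℝ k (EuclideanSpace ℝ (Fin d)) ℝ).continuous.comp_continuousOn
      (hg.2 (k + 1)))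
  refine h.congr fun p hp => ?_
  have e : partialDeriv i (g p.1) = A ∘ fderiv ℝ (g p.1) := rfl
  have hs : ContDiff ℝ ∞ (fderiv ℝ (g p.1)) := (hg.1 p.1 hp.1).fderiv_right (m := ∞) (by simp)
  simp only [Function.comp_apply]
  rw [e, A.iteratedFDeriv_comp_left (i := k) hs.contDiffAt (by exact_mod_cast le_top),
    iteratedFDeriv_succ_eq_comp_right]
  simp

theorem IsSolution.isSmoothFamily {ν T : ℝ} {h₀ : EuclideanSpace ℝ (Fin d) → ℝ}
    {h : ℝ → EuclideanSpace ℝ (Fin d) → ℝ} (hh : IsSolution ν T h₀ h) : IsSmoothFamily T h :=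
  ⟨hh.smooth, hh.continuous_derivs⟩

theorem IsSmoothFamily.continuousOn_rhs {T : ℝ} {g : ℝ → EuclideanSpace ℝ (Fin d) → ℝ}
    (hg : IsSmoothFamily T g) (ν : ℝ) :
    ContinuousOn (fun p : ℝ × EuclideanSpace ℝ (Fin d) => rhs ν (g p.1) p.2)
      (Set.Ico 0 T ×ˢ Set.univ) := by
  have h1 := fun i => (hg.pderiv i).continuousOn
  have h2 := fun i j => ((hg.pderiv i).pderiv j).continuousOn
  have h4 := fun i j => ((((hg.pderiv j).pderiv j).pderiv i).pderiv
    i).continuousOn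
  have : ContinuousOn (fun p : ℝ × EuclideanSpace ℝ (Fin d) =>
      ∑ i, ((∑ j, partialDeriv j (g p.1) p.2 ^ 2 - 1) *
        partialDeriv i (partialDeriv i (g p.1)) p.2 +
        (∑ j, 2 * (partialDeriv j (g p.1) p.2 * partialDeriv i (partialDeriv j (g p.1)) p.2)) *
          partialDeriv i (g p.1) p.2) -
      ν * ∑ i, ∑ j, partialDeriv i (partialDeriv i (partialDeriv j (partialDeriv j (g p.1)))) p.2)
      (Set.Ico 0 T ×ˢ Set.univ) := by
    refine (continuousOn_finsetSum _ fun i _ => ?_).sub (continuousOn_const.mul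
      (continuousOn_finsetSum _ fun i _ => continuousOn_finsetSum _ fun j _ => h4 i j))
    exact (((continuousOn_finsetSum _ fun j _ => (h1 j).pow 2).sub continuousOn_const).mul
      (h2 i i)).add ((continuousOn_finsetSum _ fun j _ => continuousOn_const.mul
        ((h1 j).mul (h2 j i))).mul (h1 i))
  refine this.congr fun p hp => ?_
  have hs := hg.1 p.1 hp.1
  simp only [rhs_eq hs, partialDeriv_flux hs, lap_lap hs]

/-- The cubic part `p ↦ |p|² p` is monotone: its pairing with `p - q` equals `½ (|p|² + |q|²) |p -
q|² + ½ (|p|² - |q|²)²`. Only the linear part `-p` can lose, and it loses exactly `|p - q|²`. -/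
theorem flux_monotone (p q : Fin d → ℝ) :
    0 ≤ ∑ i, (p i - q i) * ((∑ j, p j ^ 2 - 1) * p i - (∑ j, q j ^ 2 - 1) * q i) +
      ∑ i, (p i - q i) ^ 2 := by
  set P := ∑ j, p j ^ 2 with hP
  set Q := ∑ j, q j ^ 2 with hQ
  have h : ∑ i, (p i - q i) * ((P - 1) * p i - (Q - 1) * q i) + ∑ i, (p i - q i) ^ 2 =
      1 / 2 * (P + Q) * ∑ i, (p i - q i) ^ 2 + 1 / 2 * (P - Q) ^ 2 := by
    have e : (P - Q) ^ 2 = ∑ i, (P - Q) * (p i ^ 2 - q i ^ 2) := by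
      rw [← Finset.mul_sum, Finset.sum_sub_distrib, ← hP, ← hQ, pow_two]
    rw [e, Finset.mul_sum, Finset.mul_sum, ← Finset.sum_add_distrib, ← Finset.sum_add_distrib]
    refine Finset.sum_congr rfl fun i _ => ?_
    ring
  have hP0 : 0 ≤ P := Finset.sum_nonneg fun i _ => sq_nonneg _
  have hQ0 : 0 ≤ Q := Finset.sum_nonneg fun i _ => sq_nonneg _
  have : 0 ≤ ∑ i, (p i - q i) ^ 2 := Finset.sum_nonneg fun i _ => sq_nonneg _
  rw [h]
  positivity

/-- The vector field whose divergence appears in the energy identity for the difference of two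
solutions. -/
def energyField (ν : ℝ) (f g : EuclideanSpace ℝ (Fin d) → ℝ) (i : Fin d)
    (y : EuclideanSpace ℝ (Fin d)) : ℝ :=
  (f y - g y) * (flux f i y - flux g i y) +
    (f y - g y) * partialDeriv i (fun y => f y - g y) y +
    ν * (lap (fun y => f y - g y) y * partialDeriv i (fun y => f y - g y) y -
      (f y - g y) * partialDeriv i (lap fun y => f y - g y) y)

variable {f g : EuclideanSpace ℝ (Fin d) → ℝ}

theorem contDiff_energyField (ν : ℝ) (hf : ContDiff ℝ ∞ f) (hg : ContDiff ℝ ∞ g) (i : Fin d) :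
    ContDiff ℝ ∞ (energyField ν f g i) := by
  have hw : ContDiff ℝ ∞ fun y => f y - g y := hf.sub hg
  have hwi := contDiff_partialDeriv hw i
  exact ((hw.mul ((contDiff_flux hf i).sub (contDiff_flux hg i))).add (hw.mul hwi)).add
    (contDiff_const.mul (((contDiff_lap hw).mul hwi).sub
      (hw.mul (contDiff_partialDeriv (contDiff_lap hw) i))))

theorem IsPeriodic.sub (hf : IsPeriodic f) (hg : IsPeriodic g) : IsPeriodic fun y => f y - g y :=
  fun i x => by simp only [hf i x, hg i x]

theorem isPeriodic_energyField (ν : ℝ) (hf : IsPeriodic f) (hg : IsPeriodic g) (i : Fin d) :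
    IsPeriodic (energyField ν f g i) := by
  intro j x
  have hw := hf.sub hg
  simp only [energyField, hf j x, hg j x, isPeriodic_flux hf i j x, isPeriodic_flux hg i j x,
    isPeriodic_partialDeriv hw i j x, isPeriodic_lap hw j x,
    isPeriodic_partialDeriv (isPeriodic_lap hw) i j x]

/-- Put `w = f - g`. After `flux_monotone` the bad term is `|∇w|²`, which equals `-w Δw` up to a
divergence; the dissipation `-ν (Δw)²` absorbs this at the price `w² / (4 ν)` by completing the
square. -/
theorem sub_mul_rhs_sub_le {ν : ℝ} (hν : 0 < ν) (hf : ContDiff ℝ ∞ f) (hg : ContDiff ℝ ∞ g)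
    (x : EuclideanSpace ℝ (Fin d)) :
    (f x - g x) * (rhs ν f x - rhs ν g x) ≤
      ∑ i, partialDeriv i (energyField ν f g i) x + (f x - g x) ^ 2 / (4 * ν) := by
  set w : EuclideanSpace ℝ (Fin d) → ℝ := fun y => f y - g y with hw_def
  have hw : ContDiff ℝ ∞ w := hf.sub hg
  have hl : ContDiff ℝ ∞ (lap w) := contDiff_lap hw
  have hll : lap (lap f) x - lap (lap g) x = lap (lap w) x := by
    rw [← lap_sub (contDiff_lap hf) (contDiff_lap hg)]
    congr 1
    funext y
    exact (lap_sub hf hg y).symm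
  have hdiv : ∀ i, partialDeriv i (energyField ν f g i) x =
      w x * (partialDeriv i (flux f i) x - partialDeriv i (flux g i) x) +
        (partialDeriv i f x - partialDeriv i g x) * (flux f i x - flux g i x) +
        (w x * partialDeriv i (partialDeriv i w) x +
          (partialDeriv i f x - partialDeriv i g x) ^ 2) +
        ν * (lap w x * partialDeriv i (partialDeriv i w) x -
          w x * partialDeriv i (partialDeriv i (lap w)) x) := by
    intro i
    have hwi := contDiff_partialDeriv hw i
    have hli := contDiff_partialDeriv hl i
    have hff := contDiff_flux hf i
    have hfg := contDiff_flux hg i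
    have e : energyField ν f g i = fun y => (w y * (flux f i y - flux g i y) +
        w y * partialDeriv i w y) + ν * (lap w y * partialDeriv i w y -
          w y * partialDeriv i (lap w) y) := rfl
    rw [e, partialDeriv_add ((hw.mul (hff.sub hfg)).add (hw.mul hwi))
      (contDiff_const.mul ((hl.mul hwi).sub (hw.mul hli))),
      partialDeriv_add (hw.mul (hff.sub hfg)) (hw.mul hwi),
      partialDeriv_const_mul ((hl.mul hwi).sub (hw.mul hli)),
      partialDeriv_sub (hl.mul hwi) (hw.mul hli), partialDeriv_mul hw (hff.sub hfg),
      partialDeriv_mul hw hwi, partialDeriv_mul hl hwi, partialDeriv_mul hw hli,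
      partialDeriv_sub hff hfg, hw_def, partialDeriv_sub hf hg]
    ring
  simp_rw [hdiv]
  rw [Finset.sum_add_distrib, Finset.sum_add_distrib, Finset.sum_add_distrib,
    Finset.sum_add_distrib, ← Finset.mul_sum, ← Finset.mul_sum, ← Finset.mul_sum,
    Finset.sum_sub_distrib, Finset.sum_sub_distrib, ← Finset.mul_sum, ← Finset.mul_sum]
  have hm := flux_monotone (fun i => partialDeriv i f x) fun i => partialDeriv i g x
  have e1 : ∑ i, partialDeriv i (partialDeriv i w) x = lap w x := rfl
  have e2 : ∑ i, partialDeriv i (partialDeriv i (lap w)) x = lap (lap w) x := rfl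
  have e3 : ∑ i, (partialDeriv i f x - partialDeriv i g x) * (flux f i x - flux g i x) =
    ∑ i, (partialDeriv i f x - partialDeriv i g x) *
      ((∑ j, partialDeriv j f x ^ 2 - 1) * partialDeriv i f x -
        (∑ j, partialDeriv j g x ^ 2 - 1) * partialDeriv i g x) := rfl
  rw [e1, e2, e3, rhs_eq hf, rhs_eq hg]
  have hsq : 0 ≤ ν * (lap w x + w x / (2 * ν)) ^ 2 := by positivity
  have hexp : ν * (lap w x + w x / (2 * ν)) ^ 2 =
      ν * lap w x ^ 2 + w x * lap w x + w x ^ 2 / (4 * ν) := by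
    field_simp
    ring
  have hwx : f x - g x = w x := rfl
  have h5 : ν * (w x * (lap (lap f) x - lap (lap g) x)) = ν * (w x * lap (lap w) x) := by rw [hll]
  rw [hwx]
  linarith

theorem torusIntegral_sub_mul_rhs_sub_le {ν : ℝ} (hν : 0 < ν) (hf : ContDiff ℝ ∞ f)
    (hg : ContDiff ℝ ∞ g) (hpf : IsPeriodic f) (hpg : IsPeriodic g)
    (hcf : Continuous (rhs ν f)) (hcg : Continuous (rhs ν g)) :
    torusIntegral (fun x => (f x - g x) * (rhs ν f x - rhs ν g x)) ≤
      1 / (4 * ν) * torusIntegral fun x => (f x - g x) ^ 2 := by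
  have h0 := torusIntegral_sum_partialDeriv _ (contDiff_energyField ν hf hg)
    (isPeriodic_energyField ν hpf hpg)
  have hc := hf.continuous.sub hg.continuous
  have i1 := integrableOn_cell (hc.mul (hcf.sub hcg))
  have i2 := integrableOn_cell (continuous_finsetSum Finset.univ fun i _ =>
    (contDiff_partialDeriv (contDiff_energyField ν hf hg i) i).continuous)
  have i3 := (integrableOn_cell (hc.pow 2)).const_mul (1 / (4 * ν))
  have := integral_mono i1 (i2.add i3) fun x => by
    refine (sub_mul_rhs_sub_le hν hf hg x).trans (le_of_eq ?_)
    simp only [Pi.add_apply, Pi.sub_apply, Pi.pow_apply]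
    ring
  refine this.trans (le_of_eq ?_)
  rw [integral_add' i2 i3, integral_const_mul]
  simp only [torusIntegral] at h0 ⊢
  rw [h0, zero_add]
  rfl

theorem continuous_of_continuousOn_prod {T t : ℝ} {F : ℝ → EuclideanSpace ℝ (Fin d) → ℝ}
    (hF : ContinuousOn (fun p : ℝ × EuclideanSpace ℝ (Fin d) => F p.1 p.2)
      (Set.Ico 0 T ×ˢ Set.univ)) (ht : t ∈ Set.Ico 0 T) : Continuous (F t) := by
  rw [← continuousOn_univ]
  exact hF.comp (f := fun x => (t, x)) (by fun_prop) fun x _ => ⟨ht, trivial⟩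

theorem exists_bound_on_closedCell {T a b : ℝ} {F : ℝ → EuclideanSpace ℝ (Fin d) → ℝ}
    (hF : ContinuousOn (fun p : ℝ × EuclideanSpace ℝ (Fin d) => F p.1 p.2)
      (Set.Ico 0 T ×ˢ Set.univ)) (ha : 0 ≤ a) (hb : b < T) :
    ∃ M, ∀ s ∈ Set.Icc a b, ∀ x ∈ closedCell d, ‖F s x‖ ≤ M := by
  obtain ⟨M, hM⟩ := (isCompact_Icc.prod (isCompact_closedCell (d := d))).exists_bound_of_continuousOn
    (hF.mono (Set.prod_mono (fun s (hs : s ∈ Set.Icc a b) => ⟨ha.trans hs.1, hs.2.trans_lt hb⟩)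
      (Set.subset_univ _)))
  exact ⟨M, fun s hs x hx => hM (s, x) ⟨hs, hx⟩⟩

theorem measurableSet_cell :
    MeasurableSet {x : EuclideanSpace ℝ (Fin d) | ∀ i, x i ∈ Set.Ico 0 (2 * Real.pi)} := by
  simp only [Set.ofPred_forall]
  exact MeasurableSet.iInter fun i =>
    (EuclideanSpace.proj i : EuclideanSpace ℝ (Fin d) →L[ℝ] ℝ).continuous.measurable
      measurableSet_Ico

theorem integrableOn_cell_const (M : ℝ) : IntegrableOn (fun _ => M)
    {x : EuclideanSpace ℝ (Fin d) | ∀ i, x i ∈ Set.Ico 0 (2 * Real.pi)} :=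
  integrableOn_cell continuous_const

theorem ae_cell_mem_closedCell : ∀ᵐ x ∂(volume.restrict
    {x : EuclideanSpace ℝ (Fin d) | ∀ i, x i ∈ Set.Ico 0 (2 * Real.pi)}), x ∈ closedCell d := by
  filter_upwards [ae_restrict_mem measurableSet_cell] with x hx i
  exact Set.Ico_subset_Icc_self (hx i)

/-- The `L²` distance of two smooth solutions with the same initial value is zero. -/
theorem IsSolution.torusIntegral_sub_sq_eq_zero {ν T : ℝ} (hν : 0 < ν)
    {h₀ : EuclideanSpace ℝ (Fin d) → ℝ} {h k : ℝ → EuclideanSpace ℝ (Fin d) → ℝ}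
    (hh : IsSolution ν T h₀ h) (hk : IsSolution ν T h₀ k) {t : ℝ} (ht : t ∈ Set.Ico 0 T) :
    torusIntegral (fun x => (h t x - k t x) ^ 2) = 0 := by
  set y : ℝ → ℝ := fun s => torusIntegral fun x => (h s x - k s x) ^ 2 with hy
  have cw := hh.isSmoothFamily.continuousOn.sub hk.isSmoothFamily.continuousOn
  have cw2 : ContinuousOn (fun p : ℝ × EuclideanSpace ℝ (Fin d) => (h p.1 p.2 - k p.1 p.2) ^ 2)
    (Set.Ico 0 T ×ˢ Set.univ) := cw.pow 2
  have cr := (hh.isSmoothFamily.continuousOn_rhs ν).sub (hk.isSmoothFamily.continuousOn_rhs ν)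
  have cd : ContinuousOn (fun p : ℝ × EuclideanSpace ℝ (Fin d) =>
      2 * ((h p.1 p.2 - k p.1 p.2) * (rhs ν (h p.1) p.2 - rhs ν (k p.1) p.2)))
    (Set.Ico 0 T ×ˢ Set.univ) := continuousOn_const.mul (cw.mul cr)
  -- Continuity down to time zero is proved separately, because the equation is available at
  -- positive times only.
  have hcont : ContinuousOn y (Set.Icc 0 t) := by
    obtain ⟨M, hM⟩ := exists_bound_on_closedCell (F := fun s x => (h s x - k s x) ^ 2) cw2 le_rfl
      ht.2
    refine continuousOn_of_dominated (bound := fun _ => M) (fun s hs => ?_) (fun s hs => ?_)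
      (integrableOn_cell_const M) (ae_of_all _ fun x => ?_)
    · exact (continuous_of_continuousOn_prod (F := fun s x => (h s x - k s x) ^ 2) cw2
        ⟨hs.1, hs.2.trans_lt ht.2⟩).aestronglyMeasurable
    · filter_upwards [ae_cell_mem_closedCell] with x hx
      exact hM s hs x hx
    · exact cw2.comp (f := fun s => (s, x)) (by fun_prop)
        fun s hs => ⟨⟨hs.1, hs.2.trans_lt ht.2⟩, trivial⟩
  have hderiv : ∀ s ∈ Set.Ioo 0 t, HasDerivAt y (torusIntegral fun x =>
      2 * ((h s x - k s x) * (rhs ν (h s) x - rhs ν (k s) x))) s := by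
    intro s hs
    obtain ⟨M, hM⟩ := exists_bound_on_closedCell (F := fun s x =>
      2 * ((h s x - k s x) * (rhs ν (h s) x - rhs ν (k s) x))) cd le_rfl ht.2
    have hst : ∀ r ∈ Set.Ioo 0 t, r ∈ Set.Ico 0 T := fun r hr => ⟨hr.1.le, hr.2.trans ht.2⟩
    refine (hasDerivAt_integral_of_dominated_loc_of_deriv_le (bound := fun _ => M)
      (F' := fun s x => 2 * ((h s x - k s x) * (rhs ν (h s) x - rhs ν (k s) x)))
      (Ioo_mem_nhds hs.1 hs.2) ?_ ?_ ?_ ?_ (integrableOn_cell_const M) ?_).2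
    · filter_upwards [Ioo_mem_nhds hs.1 hs.2] with r hr
      exact (continuous_of_continuousOn_prod (F := fun s x => (h s x - k s x) ^ 2) cw2
        (hst r hr)).aestronglyMeasurable
    · exact integrableOn_cell (continuous_of_continuousOn_prod
        (F := fun s x => (h s x - k s x) ^ 2) cw2 (hst s hs))
    · exact (continuous_of_continuousOn_prod (F := fun s x =>
        2 * ((h s x - k s x) * (rhs ν (h s) x - rhs ν (k s) x))) cd (hst s hs)).aestronglyMeasurable
    · filter_upwards [ae_cell_mem_closedCell] with x hx r hr
      exact hM r ⟨hr.1.le, hr.2.le⟩ x hx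
    · refine ae_of_all _ fun x r hr => ?_
      have hr' : r ∈ Set.Ioo 0 T := ⟨hr.1, hr.2.trans ht.2⟩
      have := ((hh.equation r hr' x).sub (hk.equation r hr' x)).pow 2
      convert! this using 1
      simp
      ring
  have hle : ∀ s ∈ Set.Ioo 0 t, torusIntegral (fun x =>
      2 * ((h s x - k s x) * (rhs ν (h s) x - rhs ν (k s) x))) ≤ 1 / (2 * ν) * y s := by
    intro s hs
    have hs' : s ∈ Set.Ico 0 T := ⟨hs.1.le, hs.2.trans ht.2⟩
    have := torusIntegral_sub_mul_rhs_sub_le hν (hh.smooth s hs') (hk.smooth s hs')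
      (hh.periodic s hs') (hk.periodic s hs')
      (continuous_of_continuousOn_prod (F := fun s x => rhs ν (h s) x)
        (hh.isSmoothFamily.continuousOn_rhs ν) hs')
      (continuous_of_continuousOn_prod (F := fun s x => rhs ν (k s) x)
        (hk.isSmoothFamily.continuousOn_rhs ν) hs')
    have e : torusIntegral (fun x => 2 * ((h s x - k s x) * (rhs ν (h s) x - rhs ν (k s) x))) =
        2 * torusIntegral fun x => (h s x - k s x) * (rhs ν (h s) x - rhs ν (k s) x) :=
      integral_const_mul _ _
    have e2 : 2 * (1 / (4 * ν)) = 1 / (2 * ν) := by field_simp; norm_num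
    rw [e, ← e2, mul_assoc]
    gcongr
  have hexp : ∀ s, HasDerivAt (fun s => Real.exp (-(1 / (2 * ν) * s)))
      (Real.exp (-(1 / (2 * ν) * s)) * -(1 / (2 * ν) * 1)) s := fun s =>
    ((hasDerivAt_id s).const_mul _).neg.exp
  -- Grönwall's inequality by an integrating factor.
  have hanti : AntitoneOn (fun s => Real.exp (-(1 / (2 * ν) * s)) * y s) (Set.Icc 0 t) := by
    refine antitoneOn_of_deriv_nonpos (convex_Icc 0 t)
      ((by fun_prop : Continuous fun s => Real.exp (-(1 / (2 * ν) * s))).continuousOn.mul hcont)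
      (fun s hs => ?_) fun s hs => ?_
    all_goals rw [interior_Icc] at hs
    all_goals have hd := (hexp s).mul (hderiv s hs)
    · exact hd.differentiableAt.differentiableWithinAt
    · rw [show (fun s => Real.exp (-(1 / (2 * ν) * s)) * y s) =
        (fun s => Real.exp (-(1 / (2 * ν) * s))) * y from rfl, hd.deriv]
      have := hle s hs
      have := Real.exp_pos (-(1 / (2 * ν) * s))
      nlinarith
  have h0 : y 0 = 0 := by
    simp [hy, hh.initial, hk.initial, torusIntegral]
  have := hanti (Set.left_mem_Icc.2 ht.1) (Set.right_mem_Icc.2 ht.1) ht.1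
  simp only [h0, mul_zero] at this
  have hneg : y t ≤ 0 := nonpos_of_mul_nonpos_right this (Real.exp_pos _)
  exact le_antisymm hneg (integral_nonneg fun x => sq_nonneg _)

/-- Amplification is measured at the origin, so only that gradient is compared. The origin is a
corner of the cell: equality holds in the open cell and passes to its closure by continuity of the
derivatives. -/
theorem gradient_zero_eq_of_torusIntegral_sub_sq_eq_zero (hf : ContDiff ℝ ∞ f)
    (hg : ContDiff ℝ ∞ g) (h : torusIntegral (fun x => (f x - g x) ^ 2) = 0) :
    gradient f 0 = gradient g 0 := by
  set U : Set (EuclideanSpace ℝ (Fin d)) := {x | ∀ i, x i ∈ Set.Ioo 0 (2 * Real.pi)} with hU_def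
  have hU : IsOpen U := by
    simp only [hU_def, Set.ofPred_forall]
    exact isOpen_iInter_of_finite fun i => isOpen_Ioo.preimage
      (EuclideanSpace.proj i : EuclideanSpace ℝ (Fin d) →L[ℝ] ℝ).continuous
  have hc : Continuous fun x => f x - g x := hf.continuous.sub hg.continuous
  have hae : (fun x => f x - g x) =ᵐ[volume.restrict U] fun _ => 0 := by
    have h1 := (setIntegral_eq_zero_iff_of_nonneg_ae (ae_of_all _ fun x => sq_nonneg _)
      (integrableOn_cell (hc.pow 2))).1 h
    have h2 : U ⊆ {x | ∀ i, x i ∈ Set.Ico 0 (2 * Real.pi)} := fun x hx i =>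
      Set.Ioo_subset_Ico_self (hx i)
    filter_upwards [ae_restrict_of_ae_restrict_of_subset h2 h1] with x hx
    simpa using hx
  have heq : Set.EqOn f g U := fun x hx => sub_eq_zero.1
    (Measure.eqOn_open_of_ae_eq hae hU hc.continuousOn continuousOn_const hx)
  have hpart : ∀ i, Set.EqOn (partialDeriv i f) (partialDeriv i g) U := by
    intro i x hx
    have : f =ᶠ[𝓝 x] g := heq.eventuallyEq_of_mem (hU.mem_nhds hx)
    simp only [partialDeriv, this.fderiv_eq]
  have h0 : (0 : EuclideanSpace ℝ (Fin d)) ∈ closure U := by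
    have ht : Tendsto (fun n : ℕ => (1 / ((n : ℝ) + 1)) •
        (WithLp.toLp 2 fun _ => 1 : EuclideanSpace ℝ (Fin d))) atTop (𝓝 0) := by
      simpa using (tendsto_one_div_add_atTop_nhds_zero_nat (𝕜 := ℝ)).smul_const
        (WithLp.toLp 2 fun _ => 1 : EuclideanSpace ℝ (Fin d))
    refine mem_closure_of_tendsto ht (Eventually.of_forall fun n i => ?_)
    have h1 : 1 / ((n : ℝ) + 1) ≤ 1 := by
      rw [div_le_one (by positivity)]
      simp
    have h2 : 0 < 1 / ((n : ℝ) + 1) := by positivity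
    simp only [PiLp.smul_apply, smul_eq_mul, mul_one, Set.mem_Ioo]
    exact ⟨h2, by linarith [Real.pi_gt_three]⟩
  ext i
  rw [gradient_apply, gradient_apply]
  exact (hpart i).closure (contDiff_partialDeriv hf i).continuous
    (contDiff_partialDeriv hg i).continuous h0

end Uniqueness

/-! ### Rapidly decreasing sine series -/

/-- The series `∑ k, u k * sin (μ k * x + θ)`. -/
def sinSeries (μ u : ℤ → ℝ) (θ x : ℝ) : ℝ := ∑' k, u k * Real.sin (μ k * x + θ)

/-- Coefficients that decrease faster than all powers of the frequencies. -/
def RapidDecay (μ u : ℤ → ℝ) : Prop := ∀ m : ℕ, Summable fun k => |μ k| ^ m * |u k|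

section SinSeries

variable {μ u : ℤ → ℝ}

theorem RapidDecay.freq_mul (hu : RapidDecay μ u) : RapidDecay μ fun k => μ k * u k := by
  intro m
  refine (hu (m + 1)).congr fun k => ?_
  rw [abs_mul, pow_succ, mul_assoc]

theorem RapidDecay.summable_abs (hu : RapidDecay μ u) : Summable fun k => |u k| := by
  simpa using hu 0

theorem abs_mul_sin_le (a b : ℝ) : ‖a * Real.sin b‖ ≤ |a| := by
  rw [norm_mul, Real.norm_eq_abs]
  exact mul_le_of_le_one_right (abs_nonneg _) (by simpa using Real.abs_sin_le_one _)

theorem RapidDecay.summable_sin (hu : RapidDecay μ u) (θ x : ℝ) :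
    Summable fun k => u k * Real.sin (μ k * x + θ) :=
  hu.summable_abs.of_norm_bounded fun _ => abs_mul_sin_le _ _

/-- Carrying the phase `θ` keeps all derivatives in one family: each multiplies by the frequency and
advances the phase by a quarter turn. -/
theorem hasDerivAt_sinSeries (hu : RapidDecay μ u) (θ x : ℝ) :
    HasDerivAt (sinSeries μ u θ) (sinSeries μ (fun k => μ k * u k) (θ + Real.pi / 2) x) x := by
  refine hasDerivAt_tsum (y₀ := 0) (g := fun k x => u k * Real.sin (μ k * x + θ))
    (g' := fun k x => μ k * u k * Real.sin (μ k * x + (θ + Real.pi / 2)))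
    hu.freq_mul.summable_abs (fun k y => ?_) (fun k y => abs_mul_sin_le _ _) (hu.summable_sin θ 0) x
  have := ((((hasDerivAt_id y).const_mul (μ k)).add_const θ).sin).const_mul (u k)
  refine this.congr_deriv ?_
  rw [← add_assoc, Real.sin_add_pi_div_two]
  simp
  ring

theorem deriv_sinSeries (hu : RapidDecay μ u) (θ : ℝ) :
    deriv (sinSeries μ u θ) = sinSeries μ (fun k => μ k * u k) (θ + Real.pi / 2) :=
  funext fun x => (hasDerivAt_sinSeries hu θ x).deriv

theorem iteratedDeriv_sinSeries (hu : RapidDecay μ u) (θ : ℝ) (m : ℕ) :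
    RapidDecay μ (fun k => μ k ^ m * u k) ∧ iteratedDeriv m (sinSeries μ u θ) =
      sinSeries μ (fun k => μ k ^ m * u k) (θ + m * (Real.pi / 2)) := by
  induction m with
  | zero => simpa using hu
  | succ m ih =>
    have e : (fun k => μ k ^ (m + 1) * u k) = fun k => μ k * (μ k ^ m * u k) := by
      funext k
      ring
    rw [e]
    refine ⟨ih.1.freq_mul, ?_⟩
    rw [iteratedDeriv_succ, ih.2, deriv_sinSeries ih.1]
    congr 1
    push_cast
    ring

theorem contDiff_sinSeries (hu : RapidDecay μ u) (θ : ℝ) : ContDiff ℝ ∞ (sinSeries μ u θ) := by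
  refine contDiff_of_differentiable_iteratedDeriv fun m _ => ?_
  obtain ⟨h1, h2⟩ := iteratedDeriv_sinSeries hu θ m
  rw [h2]
  exact fun x => (hasDerivAt_sinSeries h1 _ x).differentiableAt

theorem RapidDecay.of_abs_le {M : ℤ → ℝ} (hM : RapidDecay μ M) (h : ∀ k, |u k| ≤ M k) :
    RapidDecay μ u := fun m =>
  (hM m).of_nonneg_of_le (fun _ => by positivity) fun k => by
    exact mul_le_mul_of_nonneg_left ((h k).trans (le_abs_self _)) (by positivity)

theorem isSmoothFamily_sinSeries {d : ℕ} {M : ℤ → ℝ} (hM : RapidDecay μ M) {c : ℤ → ℝ → ℝ}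
    (hc : ∀ k, Continuous (c k)) (hb : ∀ k t, 0 ≤ t → |c k t| ≤ M k) (θ T : ℝ) (i₀ : Fin d) :
    IsSmoothFamily T fun t (x : EuclideanSpace ℝ (Fin d)) =>
      sinSeries μ (fun k => c k t) θ (x i₀) := by
  have hd : ∀ t, 0 ≤ t → RapidDecay μ fun k => c k t := fun t ht => hM.of_abs_le fun k => hb k t ht
  refine ⟨fun t ht => contDiff_comp_coord (contDiff_sinSeries (hd t ht.1) θ) i₀, fun m => ?_⟩
  set L : EuclideanSpace ℝ (Fin d) →L[ℝ] ℝ := EuclideanSpace.proj i₀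
  have hcont : ContinuousOn (fun p : ℝ × EuclideanSpace ℝ (Fin d) =>
      sinSeries μ (fun k => μ k ^ m * c k p.1) (θ + m * (Real.pi / 2)) (L p.2))
      (Set.Ico 0 T ×ˢ Set.univ) := by
    -- Weierstrass M-test: the majorant `M` is independent of time, which yields joint continuity.
    refine continuousOn_tsum (fun k => ?_) (hM m) fun k p hp => ?_
    · have := hc k
      exact Continuous.continuousOn (by fun_prop)
    · refine (abs_mul_sin_le _ _).trans ?_
      rw [abs_mul, abs_pow]
      exact mul_le_mul_of_nonneg_left ((hb k p.1 hp.1.1).trans (le_abs_self _)) (by positivity)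
  have h := (ContinuousMultilinearMap.compContinuousLinearMapL (F := ℝ) fun _ : Fin m =>
      L).continuous.comp_continuousOn
    ((ContinuousMultilinearMap.piFieldEquiv ℝ (Fin m) ℝ).continuous.comp_continuousOn hcont)
  refine h.congr fun p hp => ?_
  have e : (fun x : EuclideanSpace ℝ (Fin d) => sinSeries μ (fun k => c k p.1) θ (x i₀)) =
      sinSeries μ (fun k => c k p.1) θ ∘ L := rfl
  simp only [Function.comp_apply]
  rw [e, L.iteratedFDeriv_comp_right (contDiff_sinSeries (hd p.1 hp.1.1) θ) p.2 (i := m)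
    (by exact_mod_cast le_top), iteratedFDeriv_eq_equiv_comp, Function.comp_apply,
    (iteratedDeriv_sinSeries (hd p.1 hp.1.1) θ m).2]
  rfl

end SinSeries

/-! ### Smooth solutions from mild solutions -/

/-- The frequency of the `k`-th mode of a `2π / N`-periodic function. -/
def freq (N : ℕ) (k : ℤ) : ℝ := k * N

theorem rapidDecay_exp_neg (N : ℕ) (A : ℝ) :
    RapidDecay (freq N) fun k => Real.exp (-|(k : ℝ)|) * A := by
  intro m
  have h := (Real.summable_pow_mul_exp_neg_nat_mul m one_pos).mul_right ((N : ℝ) ^ m * |A|)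
  refine Summable.of_nat_of_neg (h.congr fun n => ?_) (h.congr fun n => ?_)
  all_goals
    simp only [freq, abs_mul, Real.abs_exp, mul_pow]
    push_cast
    simp only [abs_neg, Nat.abs_cast, one_mul, neg_mul]
    ring

theorem one_le_abs_freq {N : ℕ} (hN : 1 ≤ N) {k : ℤ} (hk : k ≠ 0) : 1 ≤ |freq N k| := by
  rw [freq, abs_mul, Nat.abs_cast]
  have h1 : (1 : ℝ) ≤ |(k : ℝ)| := by exact_mod_cast Int.one_le_abs hk
  have h2 : (1 : ℝ) ≤ N := by exact_mod_cast hN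
  nlinarith

/-- The source of smallness: on nonzero modes `|k| ≥ 1`, so the damping dominates the cubic coupling
by a factor `ν N²`. -/
theorem freq_sq_le {ν : ℝ} (hν : 0 < ν) {N : ℕ} (hN : 1 ≤ N) (k : ℤ) :
    freq N k ^ 2 ≤ 1 / (ν * N ^ 2) * (ν * freq N k ^ 4) := by
  have h2 : (0 : ℝ) < N := by exact_mod_cast hN
  have h1 : (k : ℝ) ^ 2 ≤ (k : ℝ) ^ 4 := by
    rcases eq_or_ne k 0 with rfl | hk
    · simp
    · have h : (1 : ℝ) ≤ |(k : ℝ)| := by exact_mod_cast Int.one_le_abs hk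
      rw [← sq_abs, ← Even.pow_abs (by decide : Even 4)]
      exact pow_le_pow_right₀ h (by norm_num)
  have e : 1 / (ν * N ^ 2) * (ν * freq N k ^ 4) = k ^ 4 * (N : ℝ) ^ 2 := by
    rw [freq]
    field_simp
  rw [e, freq, mul_pow]
  gcongr

/-- The `k`-th mode of the primitive of the mild solution `α`. -/
def mode (ν : ℝ) (N : ℕ) (c : ℤ →₀ ℝ) (α : CosSeries) (k : ℤ) (t : ℝ) : ℝ :=
  Real.exp (-|(k : ℝ)|) *
    (Real.exp |(k : ℝ)| * c k / freq N k * Real.exp (-(ν * freq N k ^ 4 * t)) -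
      freq N k * duhamel (ν * freq N k ^ 4) (CosSeries.cubic α k) t)

/-- The mild formulation of the equation for the slope, with initial value `cosPoly c (N * x)`. -/
def IsMildSolution (ν : ℝ) (N : ℕ) (c : ℤ →₀ ℝ) (α : CosSeries) : Prop :=
  ∀ (k : ℤ) (t : ℝ), 0 ≤ t →
    α k t = Real.exp |(k : ℝ)| * c k * Real.exp (-(ν * freq N k ^ 4 * t)) -
      freq N k ^ 2 * duhamel (ν * freq N k ^ 4) (CosSeries.cubic α k) t

section Solution

variable {ν : ℝ} {N : ℕ} {c : ℤ →₀ ℝ} {α : CosSeries}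

theorem freq_mul_mode (hN : 1 ≤ N) (hc : c 0 = 0) (hα : IsMildSolution ν N c α) (k : ℤ) {t : ℝ}
    (ht : 0 ≤ t) : freq N k * mode ν N c α k t = Real.exp (-|(k : ℝ)|) * α k t := by
  rw [hα k t ht, mode]
  rcases eq_or_ne k 0 with rfl | hk
  · simp [freq, hc]
  · have : freq N k ≠ 0 := abs_pos.1 (zero_lt_one.trans_le (one_le_abs_freq hN hk))
    field_simp

theorem abs_mode_le (hN : 1 ≤ N) (hc : c 0 = 0) (hα : IsMildSolution ν N c α) (k : ℤ) {t : ℝ}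
    (ht : 0 ≤ t) : |mode ν N c α k t| ≤ Real.exp (-|(k : ℝ)|) * ‖α‖ := by
  rcases eq_or_ne k 0 with rfl | hk
  -- The zero mode vanishes: its frequency is `0`, and division by zero gives `0`.
  · simp [mode, freq]
  · calc |mode ν N c α k t| ≤ |freq N k| * |mode ν N c α k t| :=
          le_mul_of_one_le_left (abs_nonneg _) (one_le_abs_freq hN hk)
      _ = Real.exp (-|(k : ℝ)|) * |α k t| := by
          rw [← abs_mul, freq_mul_mode hN hc hα k ht, abs_mul, Real.abs_exp]
      _ ≤ _ := by
          gcongr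
          exact (CosSeries.abs_apply_le α k t).trans (CosSeries.norm_apply_le α k)

theorem hasDerivAt_mode (ν : ℝ) (N : ℕ) (c : ℤ →₀ ℝ) (α : CosSeries) (k : ℤ) (t : ℝ) :
    HasDerivAt (mode ν N c α k) (-(ν * freq N k ^ 4) * mode ν N c α k t -
      freq N k * (Real.exp (-|(k : ℝ)|) * CosSeries.cubic α k t)) t := by
  have h1 : HasDerivAt (fun t => Real.exp (-(ν * freq N k ^ 4 * t)))
      (Real.exp (-(ν * freq N k ^ 4 * t)) * -(ν * freq N k ^ 4 * 1)) t :=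
    ((hasDerivAt_id t).const_mul _).neg.exp
  have h2 := hasDerivAt_duhamel (ν * freq N k ^ 4) (CosSeries.cubic α k).continuous t
  refine (((h1.const_mul (Real.exp |(k : ℝ)| * c k / freq N k)).sub
    (h2.const_mul (freq N k))).const_mul (Real.exp (-|(k : ℝ)|))).congr_deriv ?_
  rw [mode]
  ring

theorem rapidDecay_mode (hN : 1 ≤ N) (hc : c 0 = 0) (hα : IsMildSolution ν N c α) {t : ℝ}
    (ht : 0 ≤ t) : RapidDecay (freq N) fun k => mode ν N c α k t :=
  (rapidDecay_exp_neg N ‖α‖).of_abs_le fun k => abs_mode_le hN hc hα k ht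

theorem eval_eq_sinSeries (β : CosSeries) (N : ℕ) (t x : ℝ) :
    CosSeries.eval t (N * x) β =
      sinSeries (freq N) (fun k => Real.exp (-|(k : ℝ)|) * β k t) (Real.pi / 2) x := by
  rw [CosSeries.eval_apply, sinSeries]
  congr 1
  funext k
  rw [Real.sin_add_pi_div_two, freq, mul_assoc (k : ℝ)]

theorem rapidDecay_coeff (β : CosSeries) (N : ℕ) (t : ℝ) :
    RapidDecay (freq N) fun k => Real.exp (-|(k : ℝ)|) * β k t :=
  (rapidDecay_exp_neg N ‖β‖).of_abs_le fun k => by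
    rw [abs_mul, Real.abs_exp]
    gcongr
    exact (CosSeries.abs_apply_le β k t).trans (CosSeries.norm_apply_le β k)

theorem deriv_primitive (hN : 1 ≤ N) (hc : c 0 = 0) (hα : IsMildSolution ν N c α) {t : ℝ}
    (ht : 0 ≤ t) : deriv (sinSeries (freq N) (fun k => mode ν N c α k t) 0) =
      fun x => CosSeries.eval t (N * x) α := by
  rw [deriv_sinSeries (rapidDecay_mode hN hc hα ht)]
  funext x
  rw [eval_eq_sinSeries, zero_add]
  simp_rw [freq_mul_mode hN hc hα _ ht]

theorem hasDerivAt_primitive (hN : 1 ≤ N) (hc : c 0 = 0) (hα : IsMildSolution ν N c α)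
    {t : ℝ} (ht : 0 < t) (x : ℝ) :
    HasDerivAt (fun s => sinSeries (freq N) (fun k => mode ν N c α k s) 0 x)
      (∑' k, (-(ν * freq N k ^ 4) * mode ν N c α k t -
        freq N k * (Real.exp (-|(k : ℝ)|) * CosSeries.cubic α k t)) *
          Real.sin (freq N k * x + 0)) t := by
  have hb : Summable fun k => |ν| * (|freq N k| ^ 4 * |Real.exp (-|(k : ℝ)|) * ‖α‖|) +
      |freq N k| ^ 1 * |Real.exp (-|(k : ℝ)|) * ‖CosSeries.cubic α‖| :=
    ((rapidDecay_exp_neg N ‖α‖ 4).mul_left _).add (rapidDecay_exp_neg N _ 1)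
  refine hasDerivAt_tsum_of_isPreconnected (t := Set.Ioi 0) (y₀ := t) hb isOpen_Ioi
    isPreconnected_Ioi (fun k s _ => (hasDerivAt_mode ν N c α k s).mul_const _)
    (fun k s hs => (abs_mul_sin_le _ _).trans ?_) ht
    ((rapidDecay_mode hN hc hα ht.le).summable_sin 0 x) ht
  refine (abs_sub _ _).trans ?_
  rw [abs_mul, abs_neg, abs_mul, abs_pow, abs_mul, abs_mul, Real.abs_exp, abs_mul, abs_mul,
    Real.abs_exp, abs_norm, abs_norm, pow_one, mul_assoc |ν|]
  gcongr
  · exact abs_mode_le hN hc hα k hs.le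
  · exact (CosSeries.abs_apply_le _ k s).trans (CosSeries.norm_apply_le _ k)

/-- A comparison of coefficients: the flux is the cosine series of `cubic α`, one derivative of
which is a sine series with a minus sign, while four derivatives of `H` return to the original
phase. -/
theorem primitive_equation (hN : 1 ≤ N) (hc : c 0 = 0) (hα : IsMildSolution ν N c α)
    {t : ℝ} (ht : 0 ≤ t) (x : ℝ) (H : ℝ → ℝ)
    (hH : H = sinSeries (freq N) (fun k => mode ν N c α k t) 0) :
    ∑' k, (-(ν * freq N k ^ 4) * mode ν N c α k t -
        freq N k * (Real.exp (-|(k : ℝ)|) * CosSeries.cubic α k t)) *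
          Real.sin (freq N k * x + 0) =
      deriv (fun s => (deriv H s ^ 2 - 1) * deriv H s) x -
        ν * deriv (deriv (deriv (deriv H))) x := by
  have h0 := rapidDecay_mode hN hc hα ht
  have hq := rapidDecay_coeff (CosSeries.cubic α) N t
  have e1 : (fun s => (deriv H s ^ 2 - 1) * deriv H s) = sinSeries (freq N)
      (fun k => Real.exp (-|(k : ℝ)|) * CosSeries.cubic α k t) (Real.pi / 2) := by
    rw [hH, deriv_primitive hN hc hα ht]
    funext s
    rw [← CosSeries.eval_cubic, eval_eq_sinSeries]
  rw [e1, deriv_sinSeries hq, hH, deriv_sinSeries h0, deriv_sinSeries h0.freq_mul,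
    deriv_sinSeries h0.freq_mul.freq_mul, deriv_sinSeries h0.freq_mul.freq_mul.freq_mul]
  simp only [sinSeries]
  rw [← tsum_mul_left, ← (hq.freq_mul.summable_sin _ x).tsum_sub
    ((h0.freq_mul.freq_mul.freq_mul.freq_mul.summable_sin _ x).mul_left ν)]
  congr 1
  funext k
  simp only [← add_assoc, Real.sin_add_pi_div_two, Real.cos_add_pi_div_two, add_zero]
  ring

/-- The `d`-dimensional solution that depends on one coordinate only. -/
def planarSolution {d : ℕ} (ν : ℝ) (N : ℕ) (c : ℤ →₀ ℝ) (α : CosSeries) (i₀ : Fin d) (t : ℝ)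
    (x : EuclideanSpace ℝ (Fin d)) : ℝ :=
  sinSeries (freq N) (fun k => mode ν N c α k t) 0 (x i₀)

theorem isPeriodic_comp_coord_sinSeries {d : ℕ} (u : ℤ → ℝ) (θ : ℝ) (i₀ : Fin d) :
    IsPeriodic fun x : EuclideanSpace ℝ (Fin d) => sinSeries (freq N) u θ (x i₀) := by
  intro i x
  rcases eq_or_ne i₀ i with rfl | hi
  · simp only [sinSeries, PiLp.add_apply, PiLp.single_apply, if_true]
    congr 1
    funext k
    have : freq N k * (x i₀ + 2 * Real.pi) + θ =
        freq N k * x i₀ + θ + ((k * N : ℤ) : ℝ) * (2 * Real.pi) := by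
      rw [freq]
      push_cast
      ring
    rw [this, Real.sin_add_int_mul_two_pi]
  · simp [hi]

theorem isSolution_planarSolution {d : ℕ} (hN : 1 ≤ N) (hc : c 0 = 0)
    (hα : IsMildSolution ν N c α) (i₀ : Fin d) (T : ℝ) :
    IsSolution ν T (planarSolution ν N c α i₀ 0) (planarSolution ν N c α i₀) := by
  have hs : IsSmoothFamily T (planarSolution ν N c α i₀) :=
    isSmoothFamily_sinSeries (rapidDecay_exp_neg N ‖α‖)
      (fun k => continuous_iff_continuousAt.2 fun t => (hasDerivAt_mode ν N c α k t).continuousAt)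
      (fun k t ht => abs_mode_le hN hc hα k ht) 0 T i₀
  refine ⟨rfl, fun t _ => isPeriodic_comp_coord_sinSeries _ _ _, hs.1, hs.2, fun t ht x => ?_⟩
  have h := hasDerivAt_primitive hN hc hα ht.1 (x i₀)
  rw [primitive_equation hN hc hα ht.1.le (x i₀) _ rfl] at h
  unfold planarSolution
  rw [rhs_comp_coord (contDiff_sinSeries (rapidDecay_mode hN hc hα ht.1.le) 0)]
  exact h

theorem norm_gradient_planarSolution {d : ℕ} (hN : 1 ≤ N) (hc : c 0 = 0)
    (hα : IsMildSolution ν N c α) (i₀ : Fin d) {t : ℝ} (ht : 0 ≤ t)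
    (x : EuclideanSpace ℝ (Fin d)) :
    ‖gradient (planarSolution ν N c α i₀ t) x‖ = |CosSeries.eval t (N * x i₀) α| := by
  unfold planarSolution
  rw [norm_gradient_comp_coord ((contDiff_sinSeries (rapidDecay_mode hN hc hα ht) 0).differentiable
    (by simp)), deriv_primitive hN hc hα ht]

theorem eval_zero_of_isMildSolution (hα : IsMildSolution ν N c α) (x : ℝ) :
    CosSeries.eval 0 x α = cosPoly c x := by
  rw [CosSeries.eval_apply, cosPoly_eq_sum]
  rw [tsum_eq_sum (s := c.support) fun k hk => by
    rw [hα k 0 le_rfl]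
    simp [Finsupp.notMem_support_iff.1 hk]]
  refine Finset.sum_congr rfl fun k _ => ?_
  have : Real.exp (-|(k : ℝ)|) * Real.exp |(k : ℝ)| = 1 := by rw [← Real.exp_add]; simp
  rw [hα k 0 le_rfl]
  simp only [mul_zero, neg_zero, Real.exp_zero, duhamel_zero_right, sub_zero]
  linear_combination (c k * Real.cos (k * x)) * this

theorem torusIntegral_planarSolution_zero {d : ℕ} (hN : 1 ≤ N) (hc : c 0 = 0)
    (hα : IsMildSolution ν N c α) (i₀ : Fin d) :
    torusIntegral (planarSolution ν N c α i₀ 0) = 0 := by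
  have h0 := rapidDecay_mode hN hc hα le_rfl
  -- Coefficients of a periodic primitive; the phase `-π / 2` below is chosen so that one derivative
  -- restores the phase `0`. The initial value is thus a divergence and has mean zero.
  set u : ℤ → ℝ := fun k => mode ν N c α k 0 / freq N k with hu
  have hmode : (fun k => freq N k * u k) = fun k => mode ν N c α k 0 := by
    funext k
    rcases eq_or_ne k 0 with rfl | hk
    · simp [mode, freq]
    · have : freq N k ≠ 0 := abs_pos.1 (zero_lt_one.trans_le (one_le_abs_freq hN hk))
      simp only [hu]
      field_simp
  have hdu : RapidDecay (freq N) u := by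
    refine (rapidDecay_exp_neg N ‖α‖).of_abs_le fun k => ?_
    refine le_trans ?_ (abs_mode_le hN hc hα k le_rfl)
    rcases eq_or_ne k 0 with rfl | hk
    · simp [hu, freq]
    · rw [hu, abs_div]
      exact div_le_self (abs_nonneg _) (one_le_abs_freq hN hk)
  set V : Fin d → EuclideanSpace ℝ (Fin d) → ℝ := fun i x =>
    if i = i₀ then sinSeries (freq N) u (-(Real.pi / 2)) (x i₀) else 0 with hV
  have hsm : ∀ i, ContDiff ℝ ∞ (V i) := by
    intro i
    by_cases hi : i = i₀
    · simpa only [hV, hi, if_true] using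
        contDiff_comp_coord (contDiff_sinSeries hdu (-(Real.pi / 2))) i₀
    · simpa only [hV, hi, if_false] using contDiff_const
  have hp : ∀ i, IsPeriodic (V i) := by
    intro i j x
    by_cases hi : i = i₀
    · simpa only [hV, hi, if_true] using isPeriodic_comp_coord_sinSeries u (-(Real.pi / 2)) i₀ j x
    · simp only [hV, hi, if_false]
  refine Eq.trans ?_ (torusIntegral_sum_partialDeriv V hsm hp)
  congr 1
  funext x
  rw [Finset.sum_eq_single i₀]
  · have : V i₀ = fun x : EuclideanSpace ℝ (Fin d) =>
        sinSeries (freq N) u (-(Real.pi / 2)) (x i₀) := by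
      funext x
      simp [hV]
    rw [this, partialDeriv_comp_coord ((contDiff_sinSeries hdu _).differentiable (by simp)),
      if_pos rfl, deriv_sinSeries hdu, hmode, neg_add_cancel, planarSolution]
  · intro i _ hi
    have : V i = fun _ => 0 := by
      funext x
      simp [hV, hi]
    rw [this]
    simp [partialDeriv]
  · simp

end Solution

/-! ### The main result -/

/-- The smallness conditions on `δ = 1 / (ν N²)` involve only the weighted norm of `c` and `ε`, not
the length of the time interval. Hence `N` can be fixed before the observation time, which itself
depends on `N`. -/
theorem exists_isMildSolution {ν : ℝ} (hν : 0 < ν) (c : ℤ →₀ ℝ) {ε : ℝ} (hε : 0 < ε) :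
    ∃ (N : ℕ) (α : CosSeries), 1 ≤ N ∧ IsMildSolution ν N c α ∧
      ∀ t, 0 ≤ t → ∑ k ∈ c.support, c k * Real.exp (-(ν * freq N k ^ 4 * t)) - ε <
        CosSeries.eval t 0 α := by
  -- The extra `1` is room for the Duhamel term, which `hn1` keeps below it.
  set R := CosSeries.weightedNorm c + 1 with hR
  have hw : 0 ≤ CosSeries.weightedNorm c := Finset.sum_nonneg fun k _ => by positivity
  have hR0 : 0 < R := by positivity
  have hlim : Tendsto (fun n : ℕ => 1 / (ν * ((n + 1 : ℕ) : ℝ) ^ 2)) atTop (𝓝 0) := by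
    have h1 : Tendsto (fun n : ℕ => (1 / ν) * (1 / ((n : ℝ) + 1)) ^ 2) atTop (𝓝 0) := by
      simpa using ((tendsto_one_div_add_atTop_nhds_zero_nat (𝕜 := ℝ)).pow 2).const_mul (1 / ν)
    refine h1.congr fun n => ?_
    push_cast
    field_simp
  have l1 : Tendsto (fun n : ℕ => 1 / (ν * ((n + 1 : ℕ) : ℝ) ^ 2) * (R ^ 3 + R)) atTop (𝓝 0) := by
    simpa only [zero_mul] using hlim.mul_const (R ^ 3 + R)
  have l2 : Tendsto (fun n : ℕ => 1 / (ν * ((n + 1 : ℕ) : ℝ) ^ 2) * (3 * R ^ 2 + 1)) atTop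
      (𝓝 0) := by
    simpa only [zero_mul] using hlim.mul_const (3 * R ^ 2 + 1)
  obtain ⟨n, hn1, hn2, hn3⟩ := ((l1.eventually_lt_const one_pos).and
    ((l1.eventually_lt_const hε).and (l2.eventually_lt_const (by norm_num : (0 : ℝ) < 1 / 2)))).exists
  have hN : 1 ≤ n + 1 := by omega
  have hκ : ∀ k, 0 ≤ ν * freq (n + 1) k ^ 4 := fun k => by positivity
  obtain ⟨α, hαL, hα⟩ := CosSeries.exists_mild_solution (fun k => freq (n + 1) k ^ 2)
    (fun k => ν * freq (n + 1) k ^ 4) (fun k => sq_nonneg _) (by positivity)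
    (freq_sq_le hν hN) hκ c (R := R) (by linarith) hn3.le
  refine ⟨n + 1, α, hN, hα, fun t ht => ?_⟩
  have h1 := (abs_le.1 ((CosSeries.abs_eval_le t 0 _).trans hαL)).1
  rw [map_sub, CosSeries.eval_linearEvolution _ hκ c ht] at h1
  simp only [mul_zero, Real.cos_zero, mul_one] at h1
  linarith

/-- A bound is required because the real supremum of an unbounded family is `0` by default. -/
theorem norm_gradient_le_gradNorm {d : ℕ} {g : EuclideanSpace ℝ (Fin d) → ℝ} {A : ℝ}
    (h : ∀ x, ‖gradient g x‖ ≤ A) (x : EuclideanSpace ℝ (Fin d)) : ‖gradient g x‖ ≤ gradNorm g :=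
  le_ciSup (f := fun x => ‖gradient g x‖) ⟨A, by rintro _ ⟨y, rfl⟩; exact h y⟩ x

theorem exists_mem_closedCell_eq {d : ℕ} {F : EuclideanSpace ℝ (Fin d) → ℝ} (hF : IsPeriodic F)
    (x : EuclideanSpace ℝ (Fin d)) : ∃ y ∈ closedCell d, F y = F x := by
  -- The coordinates are moved into the cell one at a time.
  have key : ∀ s : Finset (Fin d), ∃ y : EuclideanSpace ℝ (Fin d),
      (∀ i ∈ s, y i ∈ Set.Icc 0 (2 * Real.pi)) ∧ F y = F x := by
    intro s
    induction s using Finset.induction_on with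
    | empty => exact ⟨x, by simp, rfl⟩
    | insert i s hi ih =>
      obtain ⟨y, hy, hyx⟩ := ih
      have hper : Function.Periodic (fun r => F (y + EuclideanSpace.single i (r - y i)))
          (2 * Real.pi) := by
        intro r
        have : y + EuclideanSpace.single i (r + 2 * Real.pi - y i) =
            y + EuclideanSpace.single i (r - y i) + EuclideanSpace.single i (2 * Real.pi) := by
          rw [add_assoc, ← PiLp.single_add]
          congr 2
          ring
        simp only [this, hF i]
      obtain ⟨z, hz, hzF⟩ := hper.exists_mem_Ico₀ Real.two_pi_pos (y i)
      refine ⟨y + EuclideanSpace.single i (z - y i), fun j hj => ?_, ?_⟩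
      · by_cases hji : j = i
        · subst hji
          simpa using Set.Ico_subset_Icc_self hz
        · simpa [hji] using hy j (Finset.mem_of_mem_insert_of_ne hj hji)
      · rw [← hyx]
        have h0 : EuclideanSpace.single i (0 : ℝ) = 0 := by
          ext j
          simp
        simpa [h0] using hzF.symm
  obtain ⟨y, hy, h⟩ := key Finset.univ
  exact ⟨y, fun i => hy i (Finset.mem_univ i), h⟩

theorem exists_bound_norm_gradient {d : ℕ} {g : EuclideanSpace ℝ (Fin d) → ℝ}
    (hg : ContDiff ℝ ∞ g) (hp : IsPeriodic g) : ∃ A, ∀ x, ‖gradient g x‖ ≤ A := by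
  have hper : IsPeriodic fun x => ∑ i, partialDeriv i g x ^ 2 := fun j x => by
    simp only [isPeriodic_partialDeriv hp _ j x]
  have hc : Continuous fun x => ∑ i, partialDeriv i g x ^ 2 :=
    continuous_finsetSum _ fun i _ => (contDiff_partialDeriv hg i).continuous.pow 2
  obtain ⟨M, hM⟩ := (isCompact_closedCell (d := d)).exists_bound_of_continuousOn hc.continuousOn
  refine ⟨Real.sqrt M, fun x => Real.le_sqrt_of_sq_le ?_⟩
  obtain ⟨y, hy, hyx⟩ := exists_mem_closedCell_eq hper x
  rw [norm_gradient_sq]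
  exact hyx ▸ (le_abs_self _).trans (hM y hy)

theorem exists_amplified_solution {d : ℕ} (i₀ : Fin d) {ν : ℝ} (hν : 0 < ν) {ε : ℝ} (hε : 0 < ε) :
    ∃ h₀ : EuclideanSpace ℝ (Fin d) → ℝ, ContDiff ℝ ∞ h₀ ∧ IsPeriodic h₀ ∧
      torusIntegral h₀ = 0 ∧ gradNorm h₀ < 1 ∧ ∃ t₀ : ℝ, 0 < t₀ ∧
        (∃ (T : ℝ) (h : ℝ → EuclideanSpace ℝ (Fin d) → ℝ), t₀ < T ∧ IsSolution ν T h₀ h) ∧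
        ∀ (T : ℝ) (h : ℝ → EuclideanSpace ℝ (Fin d) → ℝ), t₀ < T → IsSolution ν T h₀ h →
          (∫ y, |lineKernel y|) - ε < gradNorm (h t₀) := by
  obtain ⟨l, c, η, hl, hc, hη, hbound, hamp⟩ := exists_amplified_cosPoly (half_pos hε)
  obtain ⟨N, α, hN, hα, hclose⟩ := exists_isMildSolution hν c (half_pos hε)
  have hsol := fun T => isSolution_planarSolution hN hc hα i₀ T
  have hN0 : (0 : ℝ) < N := by exact_mod_cast hN
  -- At this time the damping exponent `ν (k N)⁴ t₀` is `(l k)⁴`, as in `exists_amplified_cosPoly`.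
  have ht₀ : 0 < l ^ 4 / (ν * N ^ 4) := by positivity
  have h0mem : (0 : ℝ) ∈ Set.Ico (0 : ℝ) 1 := by simp
  refine ⟨planarSolution ν N c α i₀ 0, (hsol 1).smooth 0 h0mem, (hsol 1).periodic 0 h0mem,
    torusIntegral_planarSolution_zero hN hc hα i₀, ?_, l ^ 4 / (ν * N ^ 4), ht₀,
    ⟨_, _, lt_add_one _, hsol _⟩, fun T h hT hh => ?_⟩
  -- The uniform bound `η < 1` keeps the inequality strict after taking the supremum.
  · refine lt_of_le_of_lt (ciSup_le fun x => ?_) hη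
    rw [norm_gradient_planarSolution hN hc hα i₀ le_rfl, eval_zero_of_isMildSolution hα]
    exact hbound _
  · have hmem : l ^ 4 / (ν * N ^ 4) ∈ Set.Ico 0 T := ⟨ht₀.le, hT⟩
    have hgrad := gradient_zero_eq_of_torusIntegral_sub_sq_eq_zero (hh.smooth _ hmem)
      ((hsol T).smooth _ hmem) (hh.torusIntegral_sub_sq_eq_zero hν (hsol T) hmem)
    obtain ⟨A, hA⟩ := exists_bound_norm_gradient (hh.smooth _ hmem) (hh.periodic _ hmem)
    refine lt_of_lt_of_le ?_ (norm_gradient_le_gradNorm hA 0)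
    rw [hgrad, norm_gradient_planarSolution hN hc hα i₀ ht₀.le]
    have h1 := hclose _ ht₀.le
    have h2 : ∀ k : ℤ, ν * freq N k ^ 4 * (l ^ 4 / (ν * N ^ 4)) = (l * k) ^ 4 := by
      intro k
      rw [freq]
      field_simp
    simp_rw [h2] at h1
    refine lt_of_lt_of_le ?_ (le_abs_self _)
    simp only [PiLp.zero_apply, mul_zero]
    linarith

end ThinFilm

end

theorem theorem1p6 :
    ∃ C : ℕ → ℝ, C 1 = ThinFilm.kernelL1 1 ∧
      ∀ d : ℕ, 1 ≤ d → 1 < C d ∧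
        ∀ ν : ℝ, 0 < ν →
          (∀ ε : ℝ, 0 < ε →
            ∃ h₀ : EuclideanSpace ℝ (Fin d) → ℝ,
              ContDiff ℝ ∞ h₀ ∧ ThinFilm.IsPeriodic h₀ ∧
              ThinFilm.torusIntegral h₀ = 0 ∧ ThinFilm.gradNorm h₀ < 1 ∧
              ∃ t₀ : ℝ, 0 < t₀ ∧
                (∃ (T : ℝ) (h : ℝ → EuclideanSpace ℝ (Fin d) → ℝ),
                  t₀ < T ∧ ThinFilm.IsSolution ν T h₀ h) ∧
                ∀ (T : ℝ) (h : ℝ → EuclideanSpace ℝ (Fin d) → ℝ),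
                  t₀ < T → ThinFilm.IsSolution ν T h₀ h →
                    C d - ε < ThinFilm.gradNorm (h t₀)) ∧
          ∀ α : ℝ, ThinFilm.GradientBound d ν α → C d ≤ α := by
  have hC : 1 < ThinFilm.kernelL1 1 := by
    rw [ThinFilm.kernelL1_one]
    exact ThinFilm.one_lt_integral_abs_lineKernel
  -- The same constant serves in all dimensions.
  refine ⟨fun _ => ThinFilm.kernelL1 1, rfl, fun d hd => ⟨hC, fun ν hν => ?_⟩⟩
  have key := fun (ε : ℝ) (hε : 0 < ε) =>
    ThinFilm.exists_amplified_solution (⟨0, hd⟩ : Fin d) hν hε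
  simp only [← ThinFilm.kernelL1_one] at key
  refine ⟨key, fun α hα => ?_⟩
  by_contra! hlt
  -- This `ε` forces the slope at `t₀` above `max 1 α`, while the assumed bound keeps it at or below
  -- `max 1 α`. Positivity of `ε` needs the constant to exceed both `1` and `α`.
  obtain ⟨h₀, hs, hp, -, hg, t₀, ht₀, ⟨T, h, hT, hh⟩, hall⟩ :=
    key (ThinFilm.kernelL1 1 - max 1 α) (sub_pos.2 (max_lt hC hlt))
  have h1 := hall T h hT hh
  have h2 := hα h₀ hs hp T h hh t₀ ⟨ht₀, hT⟩
  have h3 : max (ThinFilm.gradNorm h₀) α ≤ max 1 α := max_le_max hg.le le_rfl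
  linarith
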